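/- Theorem 2.5 (Correctness of the Global Optima). There is an absolute constant $K>0$ such that for every $\theta\in(0,1)$ there is $p_0=p_0(\theta)$, depending only on $\theta$, with the following property. Let $C>\frac{4}{3\theta(1-\theta)}$, let $n,p\in\mathbb N$ and $\varepsilon\in[0,1]$ satisfy $p\ge p_0$ and $p\,\varepsilon^2\ge K\,\theta\,n^2\ln n$ (that is, $p\ge K\theta n^2\ln n/\varepsilon^2$ when $\varepsilon>0$), let $D_o\in\mathsf O(n;\mathbb R)$ be any orthogonal matrix, and let $X_o$ be a random $n\times p$ matrix whose entries are i.i.d. Bernoulli–Gaussian $\mathrm{BG}(\theta)$, i.e. distributed as $b\,g$ with $b\sim\mathrm{Ber}(\theta)$ and $g\sim\mathcal N(0,1)$ independent. Put $Y=D_oX_o$ and write $\|M\|_4^4=\sum_{i,j}M_{i,j}^4$. Then there is an event of probability at least $1-\frac1p$ on which, for every global maximizer $\hat A$ of $\|AY\|_4^4$ over $A\in\mathsf O(n;\mathbb R)$, there is a signed permutation matrix $P$ (an orthogonal matrix with entries in $\{0,1,-1\}$) such that $$\frac1n\bigl\|\hat A^{*}-D_oP\bigr\|_F^2\le C\varepsilon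 .$$ -/

import Mathlib

open MeasureTheory ProbabilityTheory

/-- The Bernoulli–Gaussian law `BG(θ)`: the law of a product `b * g`, where `b` is Bernoulli
(value `1` with probability `θ`, value `0` with probability `1 - θ`) and `g` is a standard Gaussian independent of `b`. -/
noncomputable def bernoulliGaussian (θ : unitInterval) : Measure ℝ :=
  ((bernoulliMeasure (1 : ℝ) 0 θ).prod (gaussianReal 0 1)).map (fun z : ℝ × ℝ => z.1 * z.2)

/-- `X` is an `n × p` Bernoulli–Gaussian matrix with parameter `θ` on the probability space
`(Ω, μ)`: its entries are independent and each of them has the law `BG(θ)`. -/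
structure IsBernoulliGaussianMatrix {Ω : Type*} [MeasurableSpace Ω] (μ : Measure Ω) (θ : unitInterval)
    {n p : ℕ} (X : Ω → Matrix (Fin n) (Fin p) ℝ) : Prop where
  hasLaw : ∀ i j, HasLaw (fun ω => X ω i j) (bernoulliGaussian θ) μ
  indep : iIndepFun (fun (ij : Fin n × Fin p) (ω : Ω) => X ω ij.1 ij.2) μ

/-- The fourth power `‖M‖₄⁴` of the entrywise `ℓ⁴`-norm of a matrix. -/
def l4Pow {n p : ℕ} (M : Matrix (Fin n) (Fin p) ℝ) : ℝ :=
  ∑ i, ∑ j, M i j ^ 4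

/-- The square `‖M‖_F²` of the Frobenius norm of a matrix. -/
def frobeniusSq {n p : ℕ} (M : Matrix (Fin n) (Fin p) ℝ) : ℝ :=
  ∑ i, ∑ j, M i j ^ 2

/-- Signed permutation matrices: orthogonal matrices all of whose entries are `0`, `1` or `-1`. -/
def IsSignedPermutation {n : ℕ} (P : Matrix (Fin n) (Fin n) ℝ) : Prop :=
  P ∈ Matrix.orthogonalGroup (Fin n) ℝ ∧ ∀ i j, P i j = 0 ∨ P i j = 1 ∨ P i j = -1

/-- `A` is a global maximizer of `B ↦ ‖B Y‖₄⁴` over the orthogonal group `O(n)`. -/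
def IsGlobalL4Maximizer {n p : ℕ} (Y : Matrix (Fin n) (Fin p) ℝ)
    (A : Matrix (Fin n) (Fin n) ℝ) : Prop :=
  A ∈ Matrix.orthogonalGroup (Fin n) ℝ ∧
    ∀ B ∈ Matrix.orthogonalGroup (Fin n) ℝ, l4Pow (B * Y) ≤ l4Pow (A * Y)

/-! Put `W = A * D`, which is orthogonal, so that the objective is the fourth power of the ℓ⁴ norm
of `W * X`. For a column x of `X` and a vector w, E⟨w,x⟩⁴ = 3θ(1-θ)‖w‖₄⁴ + 3θ²‖w‖₂⁴
(`moments_linearForm`). Summed over the rows of `W` the second term is constant, so in expectation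
the objective is an increasing affine function of ‖W‖₄⁴, whose maximum n over O(n) is attained at
signed permutations. Birkhoff's theorem makes this stable: some signed permutation P satisfies
‖W-P‖_F² ≤ 2(n-‖W‖₄⁴) (`exists_isSignedPermutation_frobeniusSq_le`).

Randomness enters only through the deviation of the empirical fourth moment from its mean.
`measureReal_fourthMomentDeviation_le` bounds it uniformly on the unit ball by truncation, Chernoff
bounds and a net. The deviation is a quartic form, so a bound on a fine net extends to the ball, and
a bound S on the ball yields the Lipschitz constant 1000 S (`IsQuarticForm.abs_sub_le`).

The Lipschitz estimate makes the error quadratic in S. With τ = θ(1-θ) and F = ‖W-P‖_F², optimality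
of W against P gives τF ≲ S ∑ᵢ‖Wᵢ-Pᵢ‖ ≤ S√(nF), hence F ≲ S²n/τ²
(`exists_isSignedPermutation_of_deviation_le`). So S of order τ√ε is enough, and concentration at
that scale needs only τ²pε ≳ (n + log p)², which the sample condition supplies once p is large in
terms of θ (`exists_forall_mul_sq_le`). -/

/-! ### The Bernoulli–Gaussian law: moments and sub-Gaussianity. -/

theorem bernoulliGaussian_eq (θ : unitInterval) :
    bernoulliGaussian θ = unitInterval.toNNReal θ • gaussianReal 0 1 +
      unitInterval.toNNReal (unitInterval.symm θ) • Measure.dirac (0 : ℝ) := by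
  have hm : Measurable (fun z : ℝ × ℝ => z.1 * z.2) := by fun_prop
  have h1 : ((Measure.dirac (1 : ℝ)).prod (gaussianReal 0 1)).map (fun z : ℝ × ℝ => z.1 * z.2)
      = gaussianReal 0 1 := by
    rw [Measure.dirac_prod, Measure.map_map hm (by fun_prop)]
    simp [Function.comp_def]
  have h0 : ((Measure.dirac (0 : ℝ)).prod (gaussianReal 0 1)).map (fun z : ℝ × ℝ => z.1 * z.2)
      = Measure.dirac 0 := by
    rw [Measure.dirac_prod, Measure.map_map hm (by fun_prop)]
    simp [Function.comp_def]
  have key : ((bernoulliMeasure (1 : ℝ) 0 θ).prod (gaussianReal 0 1)) =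
      unitInterval.toNNReal θ • (Measure.dirac (1 : ℝ)).prod (gaussianReal 0 1) +
      unitInterval.toNNReal (unitInterval.symm θ) •
        (Measure.dirac (0 : ℝ)).prod (gaussianReal 0 1) := by
    rw [bernoulliMeasure_def, Measure.add_prod]
    congr 1 <;> exact Measure.prod_smul_left _
  rw [bernoulliGaussian, key, Measure.map_add _ _ hm, Measure.map_smul, Measure.map_smul, h1, h0]

theorem integrable_bernoulliGaussian (θ : unitInterval) {f : ℝ → ℝ}
    (hf : Integrable f (gaussianReal 0 1)) : Integrable f (bernoulliGaussian θ) := by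
  rw [bernoulliGaussian_eq]
  refine Integrable.add_measure ?_ ?_
  · exact hf.smul_measure_nnreal
  · exact (integrable_dirac (by simp)).smul_measure_nnreal

theorem integral_bernoulliGaussian (θ : unitInterval) {f : ℝ → ℝ}
    (hf : Integrable f (gaussianReal 0 1)) :
    ∫ x, f x ∂bernoulliGaussian θ = θ * ∫ x, f x ∂gaussianReal 0 1 + (1 - θ) * f 0 := by
  rw [bernoulliGaussian_eq, integral_add_measure hf.smul_measure_nnreal
    (integrable_dirac (by simp)).smul_measure_nnreal, integral_smul_nnreal_measure,
    integral_smul_nnreal_measure, integral_dirac]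
  simp [NNReal.smul_def]

/-- The moment generating function is the mixture θ exp(t²/2) + (1-θ), and exp(t²/2) ≥ 1. -/
theorem hasSubgaussianMGF_bernoulliGaussian (θ : unitInterval) :
    HasSubgaussianMGF (fun x : ℝ => x) 1 (bernoulliGaussian θ) where
  integrable_exp_mul t := integrable_bernoulliGaussian θ (integrable_exp_mul_gaussianReal t)
  mgf_le t := by
    have h := mgf_id_gaussianReal (μ := 0) (v := 1)
    have h' : ∫ x, Real.exp (t * x) ∂gaussianReal 0 1 = Real.exp (t ^ 2 / 2) := by
      have := congrFun h t
      simpa [mgf] using this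
    rw [mgf, integral_bernoulliGaussian θ (integrable_exp_mul_gaussianReal t), h']
    have h1 : (1 : ℝ) ≤ Real.exp (t ^ 2 / 2) := Real.one_le_exp (by positivity)
    have := θ.2.2
    simp only [mul_zero, Real.exp_zero, mul_one, NNReal.coe_one, one_mul]
    nlinarith

theorem integrable_pow_gaussianReal (k : ℕ) :
    Integrable (fun x : ℝ => x ^ k) (gaussianReal 0 1) := by
  have := (memLp_id_gaussianReal (μ := 0) (v := 1) k).integrable_norm_pow'
  refine (integrable_norm_iff (by fun_prop)).1 ?_
  simpa using this

theorem integral_pow_gaussianReal (k : ℕ) :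
    ∫ x, x ^ k ∂gaussianReal 0 1 = iteratedDeriv k (fun t : ℝ => Real.exp (t ^ 2 / 2)) 0 := by
  have h := mgf_id_gaussianReal (μ := 0) (v := 1)
  have := iteratedDeriv_mgf_zero (X := id) (μ := gaussianReal 0 1) (by simp) k
  rw [h] at this
  simpa using this.symm

theorem iteratedDeriv_exp_sq_half :
    iteratedDeriv 2 (fun t : ℝ => Real.exp (t ^ 2 / 2)) 0 = 1 ∧
    iteratedDeriv 4 (fun t : ℝ => Real.exp (t ^ 2 / 2)) 0 = 3 := by
  have h1 : ∀ t : ℝ, HasDerivAt (fun t : ℝ => Real.exp (t ^ 2 / 2))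
      (t * Real.exp (t ^ 2 / 2)) t := by
    intro t
    convert! (((hasDerivAt_id t).pow 2).div_const 2).exp using 1
    simp; ring
  have d1 : deriv (fun t : ℝ => Real.exp (t ^ 2 / 2)) = fun t => t * Real.exp (t ^ 2 / 2) :=
    funext fun t => (h1 t).deriv
  have d2 : deriv (fun t : ℝ => t * Real.exp (t ^ 2 / 2)) =
      fun t => (1 + t ^ 2) * Real.exp (t ^ 2 / 2) := by
    funext t
    refine HasDerivAt.deriv ?_
    convert! (hasDerivAt_id t).mul (h1 t) using 1
    simp; ring
  have d3 : deriv (fun t : ℝ => (1 + t ^ 2) * Real.exp (t ^ 2 / 2)) =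
      fun t => (3 * t + t ^ 3) * Real.exp (t ^ 2 / 2) := by
    funext t
    refine HasDerivAt.deriv ?_
    convert! (((hasDerivAt_id t).pow 2).const_add 1).mul (h1 t) using 1
    simp; ring
  have d4 : deriv (fun t : ℝ => (3 * t + t ^ 3) * Real.exp (t ^ 2 / 2)) =
      fun t => (3 + 6 * t ^ 2 + t ^ 4) * Real.exp (t ^ 2 / 2) := by
    funext t
    refine HasDerivAt.deriv ?_
    convert! (((hasDerivAt_id t).const_mul 3).add ((hasDerivAt_id t).pow 3)).mul (h1 t) using 1
    simp; ring
  constructor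
  · simp [iteratedDeriv_succ, d1, d2]
  · simp [iteratedDeriv_succ, d1, d2, d3, d4]

theorem integral_sq_bernoulliGaussian (θ : unitInterval) :
    ∫ x, x ^ 2 ∂bernoulliGaussian θ = θ := by
  rw [integral_bernoulliGaussian θ (integrable_pow_gaussianReal 2), integral_pow_gaussianReal,
    iteratedDeriv_exp_sq_half.1]
  simp

theorem integral_pow_four_bernoulliGaussian (θ : unitInterval) :
    ∫ x, x ^ 4 ∂bernoulliGaussian θ = 3 * θ := by
  rw [integral_bernoulliGaussian θ (integrable_pow_gaussianReal 4), integral_pow_gaussianReal,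
    iteratedDeriv_exp_sq_half.2]
  simp [mul_comm]

theorem integral_id_bernoulliGaussian (θ : unitInterval) :
    ∫ x, x ∂bernoulliGaussian θ = 0 := by
  rw [integral_bernoulliGaussian θ (by simpa using integrable_pow_gaussianReal 1)]
  simp [integral_id_gaussianReal]

/-- A sub-Gaussian variable with variance proxy at most `1` has a square-exponential moment. -/
theorem integral_exp_sq_le_of_hasSubgaussianMGF {Ω : Type*} [MeasurableSpace Ω] {μ : Measure Ω}
    [IsProbabilityMeasure μ] {y : Ω → ℝ} {c : NNReal} (hy : HasSubgaussianMGF y c μ) (hc : c ≤ 1) :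
    Integrable (fun ω => Real.exp (y ω ^ 2 / 4)) μ ∧ ∫ ω, Real.exp (y ω ^ 2 / 4) ∂μ ≤ 2 := by
  -- Gaussian linearisation: exp(x²/4) = E exp(xg/√2) for g standard normal. After exchanging the
  -- integrals, the sub-Gaussian bound on `y` leaves E exp(g²/4) = √2.
  have hsq : ∀ x : ℝ, ∫⁻ t, ENNReal.ofReal (Real.exp (x / √2 * t)) ∂gaussianReal 0 1 =
      ENNReal.ofReal (Real.exp (x ^ 2 / 4)) := by
    intro x
    rw [← ofReal_integral_eq_lintegral_ofReal (integrable_exp_mul_gaussianReal _)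
      (ae_of_all _ fun _ => (Real.exp_pos _).le)]
    have := congrFun (mgf_id_gaussianReal (μ := 0) (v := 1)) (x / √2)
    simp only [mgf, id] at this
    rw [this]
    congr 2
    rw [div_pow, Real.sq_sqrt (by norm_num)]
    simp; ring
  have hgauss : ∫⁻ t, ENNReal.ofReal (Real.exp (t ^ 2 / 4)) ∂gaussianReal 0 1 ≤ 2 := by
    rw [gaussianReal_of_var_ne_zero _ (by norm_num : (1 : NNReal) ≠ 0),
      lintegral_withDensity_eq_lintegral_mul _ (measurable_gaussianPDF _ _) (by fun_prop)]
    have : ∀ t : ℝ, (gaussianPDF 0 1 * fun t : ℝ => ENNReal.ofReal (Real.exp (t ^ 2 / 4))) t =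
        ENNReal.ofReal ((√(2 * Real.pi))⁻¹ * Real.exp (-(1 / 4) * t ^ 2)) := by
      intro t
      simp only [Pi.mul_apply, gaussianPDF]
      rw [← ENNReal.ofReal_mul (gaussianPDFReal_nonneg _ _ _), gaussianPDFReal, mul_assoc,
        ← Real.exp_add]
      simp only [NNReal.coe_one, mul_one, sub_zero]
      congr 3; ring
    simp_rw [this]
    rw [← ofReal_integral_eq_lintegral_ofReal ((integrable_exp_neg_mul_sq (by norm_num)).const_mul _)
      (ae_of_all _ fun _ => by positivity), integral_const_mul, integral_gaussian]
    rw [← ENNReal.ofReal_ofNat 2]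
    refine ENNReal.ofReal_le_ofReal ?_
    rw [← Real.sqrt_inv, ← Real.sqrt_mul (by positivity)]
    refine Real.sqrt_le_iff.2 ⟨by norm_num, ?_⟩
    have := Real.pi_pos
    field_simp
    norm_num
  have hmain : ∫⁻ ω, ENNReal.ofReal (Real.exp (y ω ^ 2 / 4)) ∂μ ≤ 2 := by
    calc ∫⁻ ω, ENNReal.ofReal (Real.exp (y ω ^ 2 / 4)) ∂μ
        = ∫⁻ ω, ∫⁻ t, ENNReal.ofReal (Real.exp (y ω / √2 * t)) ∂gaussianReal 0 1 ∂μ := by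
          simp_rw [hsq]
      _ = ∫⁻ t, ∫⁻ ω, ENNReal.ofReal (Real.exp (y ω / √2 * t)) ∂μ ∂gaussianReal 0 1 := by
          refine lintegral_lintegral_swap ?_
          have := hy.aemeasurable
          have : AEMeasurable (fun z : Ω × ℝ => y z.1) (μ.prod (gaussianReal 0 1)) :=
            this.comp_fst
          unfold Function.uncurry
          fun_prop
      _ ≤ ∫⁻ t, ENNReal.ofReal (Real.exp (t ^ 2 / 4)) ∂gaussianReal 0 1 := by
          refine lintegral_mono fun t => ?_
          have e : ∀ ω, y ω / √2 * t = (t / √2) * y ω := fun ω => by ring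
          simp_rw [e]
          rw [← ofReal_integral_eq_lintegral_ofReal (hy.integrable_exp_mul _)
            (ae_of_all _ fun _ => (Real.exp_pos _).le)]
          refine ENNReal.ofReal_le_ofReal ((hy.mgf_le _).trans (Real.exp_le_exp.2 ?_))
          rw [div_pow, Real.sq_sqrt (by norm_num)]
          have : (c : ℝ) ≤ 1 := by exact_mod_cast hc
          nlinarith [sq_nonneg t]
      _ ≤ 2 := hgauss
  have hmeas : AEStronglyMeasurable (fun ω => Real.exp (y ω ^ 2 / 4)) μ := by
    have := hy.aemeasurable
    exact AEMeasurable.aestronglyMeasurable (by fun_prop)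
  have hint : Integrable (fun ω => Real.exp (y ω ^ 2 / 4)) μ := by
    refine ⟨hmeas, ?_⟩
    rw [hasFiniteIntegral_iff_ofReal (ae_of_all _ fun _ => (Real.exp_pos _).le)]
    exact hmain.trans_lt (by norm_num)
  refine ⟨hint, ?_⟩
  rw [← ENNReal.ofReal_le_ofReal_iff (by norm_num), ofReal_integral_eq_lintegral_ofReal hint
    (ae_of_all _ fun _ => (Real.exp_pos _).le)]
  simpa using hmain

theorem hasSubgaussianMGF_of_hasLaw_bernoulliGaussian {Ω : Type*} [MeasurableSpace Ω]
    {μ : Measure Ω} {θ : unitInterval} {x : Ω → ℝ} (hx : HasLaw x (bernoulliGaussian θ) μ) :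
    HasSubgaussianMGF x 1 μ := by
  have h := hasSubgaussianMGF_bernoulliGaussian θ
  rw [← hx.map_eq] at h
  exact HasSubgaussianMGF.of_map (Y := x) (X := fun t : ℝ => t) hx.aemeasurable h

/-! ### Linear forms in independent Bernoulli–Gaussian variables. -/

section LinearForm

variable {Ω ι : Type*} [MeasurableSpace Ω] {μ : Measure Ω}
  {θ : unitInterval} {x : ι → Ω → ℝ}

theorem hasSubgaussianMGF_linearForm (hx : ∀ k, HasLaw (x k) (bernoulliGaussian θ) μ)
    (hi : iIndepFun x μ) (w : ι → ℝ) (s : Finset ι) :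
    HasSubgaussianMGF (fun ω => ∑ k ∈ s, w k * x k ω)
      (∑ k ∈ s, (w k ^ 2).toNNReal) μ := by
  have h1 : iIndepFun (fun k ω => w k * x k ω) μ :=
    hi.comp (fun k y => w k * y) (fun k => by fun_prop)
  refine HasSubgaussianMGF.sum_of_iIndepFun h1 fun k _ => ?_
  have h := (hasSubgaussianMGF_of_hasLaw_bernoulliGaussian (hx k)).const_mul (w k)
  convert! h using 1
  ext
  simp only [Real.coe_toNNReal _ (sq_nonneg _)]
  exact (mul_one (w k ^ 2)).symm

theorem integrable_pow_of_hasSubgaussianMGF [IsFiniteMeasure μ] {y : Ω → ℝ} {c : NNReal}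
    (hy : HasSubgaussianMGF y c μ) (k : ℕ) : Integrable (fun ω => y ω ^ k) μ := by
  refine (integrable_norm_iff (hy.aestronglyMeasurable.pow k)).1 ?_
  simpa using (hy.memLp k).integrable_norm_pow'

/-- Induction on the support, splitting off one independent term. The mixed terms Y³Z and YZ³ vanish
because Z and Y are centred, so no third moment is needed, but the mean must be carried along. The
coefficient 3θ(1-θ) is E x⁴ - 3(E x²)² = 3θ - 3θ². -/
theorem moments_linearForm [IsProbabilityMeasure μ]
    (hx : ∀ k, HasLaw (x k) (bernoulliGaussian θ) μ)
    (hi : iIndepFun x μ) (w : ι → ℝ) (s : Finset ι) :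
    ∫ ω, (∑ k ∈ s, w k * x k ω) ∂μ = 0 ∧
    ∫ ω, (∑ k ∈ s, w k * x k ω) ^ 2 ∂μ = θ * ∑ k ∈ s, w k ^ 2 ∧
    ∫ ω, (∑ k ∈ s, w k * x k ω) ^ 4 ∂μ =
      3 * θ * (1 - θ) * ∑ k ∈ s, w k ^ 4 + 3 * θ ^ 2 * (∑ k ∈ s, w k ^ 2) ^ 2 := by
  classical
  induction s using Finset.induction_on with
  | empty => simp
  | insert a s ha ih =>
    obtain ⟨e1, e2, e4⟩ := ih
    have hY := hasSubgaussianMGF_linearForm hx hi w s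
    have hZ := hasSubgaussianMGF_linearForm hx hi w {a}
    set Y : Ω → ℝ := fun ω => ∑ k ∈ s, w k * x k ω with hYdef
    set Z : Ω → ℝ := fun ω => w a * x a ω with hZdef
    simp only [Finset.sum_singleton] at hZ
    have hind : IndepFun Y Z μ := by
      have h1 : iIndepFun (fun k ω => w k * x k ω) μ :=
        hi.comp (fun k y => w k * y) (fun k => by fun_prop)
      have := h1.indepFun_finsetSum_of_notMem₀ (fun k => (hx k).aemeasurable.const_mul (w k)) ha
      convert this using 1
      ext ω; simp [hYdef]
    have hYi := fun k => integrable_pow_of_hasSubgaussianMGF hY k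
    have hZi : ∀ k : ℕ, Integrable (fun ω => Z ω ^ k) μ := fun k =>
      integrable_pow_of_hasSubgaussianMGF hZ k
    have hpow : ∀ i j : ℕ, IndepFun (fun ω => Y ω ^ i) (fun ω => Z ω ^ j) μ := fun i j =>
      hind.comp (φ := fun y => y ^ i) (ψ := fun z => z ^ j) (by fun_prop) (by fun_prop)
    have hmi : ∀ i j : ℕ, Integrable (fun ω => Y ω ^ i * Z ω ^ j) μ := fun i j =>
      (hpow i j).integrable_mul (hYi i) (hZi j)
    have hmm : ∀ i j : ℕ, ∫ ω, Y ω ^ i * Z ω ^ j ∂μ = (∫ ω, Y ω ^ i ∂μ) * ∫ ω, Z ω ^ j ∂μ :=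
      fun i j => (hpow i j).integral_fun_mul_eq_mul_integral (hYi i).1 (hZi j).1
    have hlaw : ∀ k : ℕ, ∫ ω, Z ω ^ k ∂μ = w a ^ k * ∫ t, t ^ k ∂bernoulliGaussian θ := by
      intro k
      have := (hx a).integral_comp (f := fun t : ℝ => t ^ k) (by fun_prop)
      simp only [Function.comp_def] at this
      simp only [hZdef, mul_pow]
      rw [integral_const_mul, this]
    have z1 : ∫ ω, Z ω ∂μ = 0 := by
      have := hlaw 1
      simpa [integral_id_bernoulliGaussian] using this
    have z2 := hlaw 2
    rw [integral_sq_bernoulliGaussian] at z2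
    have z4 := hlaw 4
    rw [integral_pow_four_bernoulliGaussian] at z4
    have hsum : ∀ ω, ∑ k ∈ insert a s, w k * x k ω = Y ω + Z ω := by
      intro ω; rw [Finset.sum_insert ha, add_comm]
    have hY1 : Integrable Y μ := hY.integrable
    have hZ1 : Integrable Z μ := hZ.integrable
    have e1' : ∫ ω, Y ω ∂μ = 0 := e1
    simp_rw [hsum, Finset.sum_insert ha]
    refine ⟨?_, ?_, ?_⟩
    · rw [integral_add hY1 hZ1, e1', z1, add_zero]
    · have hexp : ∀ ω, (Y ω + Z ω) ^ 2 = Y ω ^ 2 + (2 * (Y ω ^ 1 * Z ω ^ 1) + Z ω ^ 2) :=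
        fun ω => by ring
      simp_rw [hexp]
      have i1 : Integrable (fun ω => 2 * (Y ω ^ 1 * Z ω ^ 1) + Z ω ^ 2) μ :=
        ((hmi 1 1).const_mul 2).add (hZi 2)
      rw [integral_add (hYi 2) i1,
        integral_add ((hmi 1 1).const_mul 2) (hZi 2), integral_const_mul, hmm, z2, e2]
      simp only [pow_one]
      rw [z1]
      ring
    · have hexp : ∀ ω, (Y ω + Z ω) ^ 4 = Y ω ^ 4 + (4 * (Y ω ^ 3 * Z ω ^ 1) +
          (6 * (Y ω ^ 2 * Z ω ^ 2) + (4 * (Y ω ^ 1 * Z ω ^ 3) + Z ω ^ 4))) :=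
        fun ω => by ring
      simp_rw [hexp]
      have i1 : Integrable (fun ω => 4 * (Y ω ^ 1 * Z ω ^ 3) + Z ω ^ 4) μ :=
        ((hmi 1 3).const_mul 4).add (hZi 4)
      have i2 : Integrable (fun ω => 6 * (Y ω ^ 2 * Z ω ^ 2) +
          (4 * (Y ω ^ 1 * Z ω ^ 3) + Z ω ^ 4)) μ := ((hmi 2 2).const_mul 6).add i1
      have i3 : Integrable (fun ω => 4 * (Y ω ^ 3 * Z ω ^ 1) + (6 * (Y ω ^ 2 * Z ω ^ 2) +
          (4 * (Y ω ^ 1 * Z ω ^ 3) + Z ω ^ 4))) μ := ((hmi 3 1).const_mul 4).add i2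
      rw [integral_add (hYi 4) i3, integral_add ((hmi 3 1).const_mul 4) i2,
        integral_add ((hmi 2 2).const_mul 6) i1, integral_add ((hmi 1 3).const_mul 4) (hZi 4)]
      have e2' : ∫ ω, Y ω ^ 2 ∂μ = θ * ∑ k ∈ s, w k ^ 2 := e2
      have e4' : ∫ ω, Y ω ^ 4 ∂μ =
        3 * θ * (1 - θ) * ∑ k ∈ s, w k ^ 4 + 3 * θ ^ 2 * (∑ k ∈ s, w k ^ 2) ^ 2 := e4
      have h31 : ∫ ω, Y ω ^ 3 * Z ω ^ 1 ∂μ = 0 := by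
        rw [hmm]; simp only [pow_one]; rw [z1, mul_zero]
      have h13 : ∫ ω, Y ω ^ 1 * Z ω ^ 3 ∂μ = 0 := by
        rw [hmm]; simp only [pow_one]; rw [e1', zero_mul]
      simp only [integral_const_mul, h31, h13, hmm 2 2, z2, e2', z4, e4']
      ring

end LinearForm

/-! ### Exponential moments of fourth powers, and the Chernoff bound. -/

section ExponentialMoments

variable {Ω : Type*} [MeasurableSpace Ω] {μ : Measure Ω} {y : Ω → ℝ}

/-- One term of the exponential series, (t²/8)⁴/4! ≤ exp(t²/8); the constant is 8⁴·4!. -/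
theorem pow_eight_mul_exp_le (t : ℝ) :
    t ^ 8 * Real.exp (t ^ 2 / 8) ≤ 98304 * Real.exp (t ^ 2 / 4) := by
  have h := Real.pow_div_factorial_le_exp (t ^ 2 / 8) (by positivity) 4
  have h2 : Real.exp (t ^ 2 / 4) = Real.exp (t ^ 2 / 8) * Real.exp (t ^ 2 / 8) := by
    rw [← Real.exp_add]; congr 1; ring
  rw [h2, ← mul_assoc]
  refine mul_le_mul_of_nonneg_right ?_ (Real.exp_pos _).le
  norm_num [Nat.factorial] at h
  nlinarith

theorem integral_pow_eight_mul_exp_le [IsProbabilityMeasure μ] {c : NNReal}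
    (hy : HasSubgaussianMGF y c μ) (hc : c ≤ 1) :
    Integrable (fun ω => y ω ^ 8 * Real.exp (y ω ^ 2 / 8)) μ ∧
      ∫ ω, y ω ^ 8 * Real.exp (y ω ^ 2 / 8) ∂μ ≤ 196608 := by
  obtain ⟨hi, hb⟩ := integral_exp_sq_le_of_hasSubgaussianMGF hy hc
  have hm : AEStronglyMeasurable (fun ω => y ω ^ 8 * Real.exp (y ω ^ 2 / 8)) μ := by
    have := hy.aemeasurable
    exact AEMeasurable.aestronglyMeasurable (by fun_prop)
  have hint : Integrable (fun ω => y ω ^ 8 * Real.exp (y ω ^ 2 / 8)) μ :=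
    (hi.const_mul 98304).mono' hm (ae_of_all _ fun ω => by
      rw [Real.norm_of_nonneg (by positivity)]
      exact pow_eight_mul_exp_le _)
  refine ⟨hint, ?_⟩
  calc _ ≤ ∫ ω, 98304 * Real.exp (y ω ^ 2 / 4) ∂μ :=
        integral_mono hint (hi.const_mul _) fun ω => pow_eight_mul_exp_le _
    _ ≤ _ := by rw [integral_const_mul]; linarith

/-- Taylor's formula with remainder. Keeping the factor exp u in the remainder is what allows it to
be absorbed into a square-exponential moment. -/
theorem exp_le_one_add_add_sq_mul_exp {u : ℝ} (hu : 0 ≤ u) :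
    Real.exp u ≤ 1 + u + u ^ 2 / 2 * Real.exp u := by
  have hmono : ∀ t ∈ Set.Ici (0 : ℝ), (1 - t ^ 2 / 2) * Real.exp t - t ≤ 1 := by
    intro t ht
    have hanti : AntitoneOn (fun t : ℝ => (1 - t ^ 2 / 2) * Real.exp t - t) (Set.Ici 0) := by
      refine antitoneOn_of_deriv_nonpos (convex_Ici 0) (by fun_prop) (by fun_prop) ?_
      intro r hr
      rw [interior_Ici] at hr
      have hd : HasDerivAt (fun t : ℝ => (1 - t ^ 2 / 2) * Real.exp t - t)
          ((1 - r - r ^ 2 / 2) * Real.exp r - 1) r := by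
        convert! (((((hasDerivAt_id r).pow 2).div_const 2).const_sub 1).mul
          (Real.hasDerivAt_exp r)).sub (hasDerivAt_id r) using 1
        simp; ring
      rw [hd.deriv]
      have : (1 - r - r ^ 2 / 2) ≤ Real.exp (-r) := by
        nlinarith [Real.add_one_le_exp (-r), sq_nonneg r]
      have h5 := mul_le_mul_of_nonneg_right this (Real.exp_pos r).le
      rw [← Real.exp_add] at h5
      simp at h5
      linarith
    have := hanti (Set.mem_Ici.2 le_rfl) ht ht
    simpa using this
  nlinarith [hmono u hu]

theorem exp_neg_le_one_sub_add_sq {u : ℝ} (hu : 0 ≤ u) :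
    Real.exp (-u) ≤ 1 - u + u ^ 2 / 2 := by
  have hmono : MonotoneOn (fun t : ℝ => 1 - t + t ^ 2 / 2 - Real.exp (-t)) (Set.Ici 0) := by
    refine monotoneOn_of_deriv_nonneg (convex_Ici 0) (by fun_prop) (by fun_prop) ?_
    intro r hr
    have hd : HasDerivAt (fun t : ℝ => 1 - t + t ^ 2 / 2 - Real.exp (-t))
        (-1 + r + Real.exp (-r)) r := by
      convert! (((hasDerivAt_id r).const_sub 1).add (((hasDerivAt_id r).pow 2).div_const 2)).sub
        (hasDerivAt_id r).neg.exp using 1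
      simp
    rw [hd.deriv]
    linarith [Real.add_one_le_exp (-r)]
  have := hmono (Set.mem_Ici.2 le_rfl) hu hu
  simp at this
  linarith

/-- Upper exponential moment of a truncation `ξ` of `y ^ 4`, centred at `E y ^ 4`. -/
theorem mgf_truncated_pow_four_sub_le [IsProbabilityMeasure μ] {c : NNReal}
    (hy : HasSubgaussianMGF y c μ) (hc : c ≤ 1)
    {ξ : Ω → ℝ} (hξ : AEMeasurable ξ μ) (h0 : ∀ ω, 0 ≤ ξ ω) (h4 : ∀ ω, ξ ω ≤ y ω ^ 4) {B s : ℝ}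
    (hB : ∀ ω, ξ ω ≤ B * y ω ^ 2) (hs : 0 ≤ s) (hsB : s * B ≤ 1 / 8) :
    Integrable (fun ω => Real.exp (s * (ξ ω - ∫ ω, y ω ^ 4 ∂μ))) μ ∧
      mgf (fun ω => ξ ω - ∫ ω, y ω ^ 4 ∂μ) μ s ≤ Real.exp (98304 * s ^ 2) := by
  set G := ∫ ω, y ω ^ 4 ∂μ with hG
  obtain ⟨i8, b8⟩ := integral_pow_eight_mul_exp_le hy hc
  have i4 := integrable_pow_of_hasSubgaussianMGF hy 4
  -- The fourth power itself may have no exponential moment. Truncation makes the exponent quadratic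
  -- in `y`, within reach of the square-exponential moment.
  have hsξ : ∀ ω, s * ξ ω ≤ y ω ^ 2 / 8 := fun ω => by
    have h1 := mul_le_mul_of_nonneg_left (hB ω) hs
    have h2 := mul_le_mul_of_nonneg_right hsB (sq_nonneg (y ω))
    linarith
  have hpt : ∀ ω, Real.exp (s * ξ ω) ≤
      1 + s * y ω ^ 4 + s ^ 2 / 2 * (y ω ^ 8 * Real.exp (y ω ^ 2 / 8)) := fun ω => by
    have h1 := exp_le_one_add_add_sq_mul_exp (mul_nonneg hs (h0 ω))
    have h2 : (s * ξ ω) ^ 2 / 2 * Real.exp (s * ξ ω) ≤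
        s ^ 2 / 2 * (y ω ^ 8 * Real.exp (y ω ^ 2 / 8)) := by
      have h3 : ξ ω ^ 2 ≤ y ω ^ 8 := by
        have := pow_le_pow_left₀ (h0 ω) (h4 ω) 2
        calc _ ≤ (y ω ^ 4) ^ 2 := this
          _ = _ := by ring
      have h5 := Real.exp_le_exp.2 (hsξ ω)
      calc _ = s ^ 2 / 2 * (ξ ω ^ 2 * Real.exp (s * ξ ω)) := by ring
        _ ≤ _ := by gcongr
    have h6 := mul_le_mul_of_nonneg_left (h4 ω) hs
    linarith
  have hdom : Integrable
      (fun ω => 1 + s * y ω ^ 4 + s ^ 2 / 2 * (y ω ^ 8 * Real.exp (y ω ^ 2 / 8))) μ :=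
    ((integrable_const 1).add (i4.const_mul s)).add (i8.const_mul _)
  have hint0 : Integrable (fun ω => Real.exp (s * ξ ω)) μ := by
    refine hdom.mono' (AEMeasurable.aestronglyMeasurable (by fun_prop)) (ae_of_all _ fun ω => ?_)
    rw [Real.norm_of_nonneg (Real.exp_pos _).le]
    exact hpt ω
  have hfac : ∀ ω, Real.exp (s * (ξ ω - G)) = Real.exp (-(s * G)) * Real.exp (s * ξ ω) := fun ω => by
    rw [← Real.exp_add]; congr 1; ring
  refine ⟨by simp_rw [hfac]; exact hint0.const_mul _, ?_⟩
  rw [mgf]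
  simp_rw [hfac]
  rw [integral_const_mul]
  have hle : ∫ ω, Real.exp (s * ξ ω) ∂μ ≤ Real.exp (s * G + 98304 * s ^ 2) := by
    calc _ ≤ ∫ ω, (1 + s * y ω ^ 4 + s ^ 2 / 2 * (y ω ^ 8 * Real.exp (y ω ^ 2 / 8))) ∂μ :=
          integral_mono hint0 hdom hpt
      _ = 1 + s * G + s ^ 2 / 2 * ∫ ω, y ω ^ 8 * Real.exp (y ω ^ 2 / 8) ∂μ := by
          have i1 : Integrable (fun ω => 1 + s * y ω ^ 4) μ :=
            (integrable_const 1).add (i4.const_mul s)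
          rw [integral_add i1 (i8.const_mul _),
            integral_add (integrable_const 1) (i4.const_mul s), integral_const_mul,
            integral_const_mul]
          simp [hG]
      _ ≤ s * G + 98304 * s ^ 2 + 1 := by nlinarith [sq_nonneg s]
      _ ≤ _ := Real.add_one_le_exp _
  calc _ ≤ Real.exp (-(s * G)) * Real.exp (s * G + 98304 * s ^ 2) := by gcongr
    _ = _ := by rw [← Real.exp_add]; congr 1; ring

/-- Lower exponential moment of `y ^ 4`, centred at its mean. -/
theorem mgf_sub_pow_four_le [IsProbabilityMeasure μ] {c : NNReal}
    (hy : HasSubgaussianMGF y c μ) (hc : c ≤ 1)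
    {s : ℝ} (hs : 0 ≤ s) :
    Integrable (fun ω => Real.exp (s * ((∫ ω, y ω ^ 4 ∂μ) - y ω ^ 4))) μ ∧
      mgf (fun ω => (∫ ω, y ω ^ 4 ∂μ) - y ω ^ 4) μ s ≤ Real.exp (98304 * s ^ 2) := by
  set G := ∫ ω, y ω ^ 4 ∂μ with hG
  obtain ⟨i8, b8⟩ := integral_pow_eight_mul_exp_le hy hc
  have i4 := integrable_pow_of_hasSubgaussianMGF hy 4
  -- A nonpositive exponent needs no truncation. The factor exp(y²/8) ≥ 1 is inserted only to reuse
  -- the eighth-moment bound of the upper tail.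
  have hpt : ∀ ω, Real.exp (-(s * y ω ^ 4)) ≤
      1 - s * y ω ^ 4 + s ^ 2 / 2 * (y ω ^ 8 * Real.exp (y ω ^ 2 / 8)) := fun ω => by
    have h1 := exp_neg_le_one_sub_add_sq (u := s * y ω ^ 4) (by positivity)
    have h2 : (s * y ω ^ 4) ^ 2 / 2 ≤ s ^ 2 / 2 * (y ω ^ 8 * Real.exp (y ω ^ 2 / 8)) := by
      have h5 : 1 ≤ Real.exp (y ω ^ 2 / 8) := Real.one_le_exp (by positivity)
      calc _ = s ^ 2 / 2 * (y ω ^ 8 * 1) := by ring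
        _ ≤ _ := by gcongr
    linarith
  have hdom : Integrable
      (fun ω => 1 - s * y ω ^ 4 + s ^ 2 / 2 * (y ω ^ 8 * Real.exp (y ω ^ 2 / 8))) μ :=
    ((integrable_const 1).sub (i4.const_mul s)).add (i8.const_mul _)
  have hint0 : Integrable (fun ω => Real.exp (-(s * y ω ^ 4))) μ := by
    have := hy.aemeasurable
    refine hdom.mono' (AEMeasurable.aestronglyMeasurable (by fun_prop)) (ae_of_all _ fun ω => ?_)
    rw [Real.norm_of_nonneg (Real.exp_pos _).le]
    exact hpt ω
  have hfac : ∀ ω, Real.exp (s * (G - y ω ^ 4)) = Real.exp (s * G) * Real.exp (-(s * y ω ^ 4)) :=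
    fun ω => by rw [← Real.exp_add]; congr 1; ring
  refine ⟨by simp_rw [hfac]; exact hint0.const_mul _, ?_⟩
  rw [mgf]
  simp_rw [hfac]
  rw [integral_const_mul]
  have hle : ∫ ω, Real.exp (-(s * y ω ^ 4)) ∂μ ≤ Real.exp (-(s * G) + 98304 * s ^ 2) := by
    calc _ ≤ ∫ ω, (1 - s * y ω ^ 4 + s ^ 2 / 2 * (y ω ^ 8 * Real.exp (y ω ^ 2 / 8))) ∂μ :=
          integral_mono hint0 hdom hpt
      _ = 1 - s * G + s ^ 2 / 2 * ∫ ω, y ω ^ 8 * Real.exp (y ω ^ 2 / 8) ∂μ := by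
          have i1 : Integrable (fun ω => 1 - s * y ω ^ 4) μ :=
            (integrable_const 1).sub (i4.const_mul s)
          rw [integral_add i1 (i8.const_mul _),
            integral_sub (integrable_const 1) (i4.const_mul s), integral_const_mul,
            integral_const_mul]
          simp [hG]
      _ ≤ -(s * G) + 98304 * s ^ 2 + 1 := by nlinarith [sq_nonneg s]
      _ ≤ _ := Real.add_one_le_exp _
  calc _ ≤ Real.exp (s * G) * Real.exp (-(s * G) + 98304 * s ^ 2) := by gcongr
    _ = _ := by rw [← Real.exp_add]; congr 1; ring

/-- Chernoff bound for a sum of independent variables with a common bound on the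
moment generating function. -/
theorem measureReal_sum_ge_le_of_mgf_le {ι : Type*} [Fintype ι] {Z : ι → Ω → ℝ}
    (hi : iIndepFun Z μ) (hm : ∀ j, AEMeasurable (Z j) μ) {s K : ℝ} (hs : 0 ≤ s)
    (hint : ∀ j, Integrable (fun ω => Real.exp (s * Z j ω)) μ)
    (hmgf : ∀ j, mgf (Z j) μ s ≤ Real.exp K) (t : ℝ) :
    μ.real {ω | t ≤ ∑ j, Z j ω} ≤ Real.exp (-s * t + Fintype.card ι * K) := by
  have := hi.isProbabilityMeasure
  have hsum : (fun ω => ∑ j, Z j ω) = ∑ j, Z j := by ext ω; simp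
  have hI : Integrable (fun ω => Real.exp (s * ∑ j, Z j ω)) μ := by
    classical
    have : ∀ S : Finset ι, Integrable (fun ω => Real.exp (s * (∑ j ∈ S, Z j) ω)) μ := by
      intro S
      induction S using Finset.induction_on with
      | empty => simp
      | insert a S ha ih =>
        rw [Finset.sum_insert ha]
        exact (hi.indepFun_finsetSum_of_notMem₀ hm ha).symm.integrable_exp_mul_add (hint a) ih
    simpa using this Finset.univ
  refine (measure_ge_le_exp_mul_mgf t hs hI).trans ?_
  rw [Real.exp_add, hsum, hi.mgf_sum₀ hm]
  refine mul_le_mul_of_nonneg_left ?_ (Real.exp_pos _).le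
  calc ∏ j, mgf (Z j) μ s ≤ ∏ _j : ι, Real.exp K :=
        Finset.prod_le_prod (fun _ _ => mgf_nonneg) fun j _ => hmgf j
    _ = _ := by rw [Finset.prod_const, ← Real.exp_nat_mul]; simp

end ExponentialMoments

/-! ### Nets of the unit ball by volume comparison. -/

section Net

variable {E : Type*} [NormedAddCommGroup E] [NormedSpace ℝ E] [FiniteDimensional ℝ E]

/-- Balls of radius δ/2 around the points are disjoint and lie in the ball of radius 1 + δ/2;
compare Haar volumes. -/
theorem card_le_of_separated_unit_ball {δ : ℝ} (hδ : 0 < δ) (s : Finset E)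
    (hs : ∀ c ∈ s, ‖c‖ ≤ 1) (h : ∀ c ∈ s, ∀ d ∈ s, c ≠ d → δ ≤ ‖c - d‖) :
    (s.card : ℝ) ≤ (1 + 2 / δ) ^ Module.finrank ℝ E := by
  borelize E
  let μ : Measure E := Measure.addHaar
  have hD : Set.Pairwise (s : Set E) (Function.onFun Disjoint fun c => Metric.ball (c : E) (δ / 2)) := by
    rintro c hc d hd hcd
    apply Metric.ball_disjoint_ball
    rw [dist_eq_norm]
    linarith [h c hc d hd hcd]
  have hsub : (⋃ c ∈ s, Metric.ball (c : E) (δ / 2)) ⊆ Metric.ball (0 : E) (1 + δ / 2) := by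
    refine Set.iUnion₂_subset fun x hx => ?_
    apply Metric.ball_subset_ball'
    rw [dist_zero_right]
    linarith [hs x hx]
  have I : (s.card : ENNReal) * ENNReal.ofReal ((δ / 2) ^ Module.finrank ℝ E) * μ (Metric.ball 0 1) ≤
      ENNReal.ofReal ((1 + δ / 2) ^ Module.finrank ℝ E) * μ (Metric.ball 0 1) :=
    calc
      _ = μ (⋃ c ∈ s, Metric.ball (c : E) (δ / 2)) := by
        rw [measure_biUnion_finset hD fun c _ => measurableSet_ball]
        simp only [μ.addHaar_ball_of_pos _ (half_pos hδ)]
        simp only [Finset.sum_const, nsmul_eq_mul, mul_assoc]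
      _ ≤ μ (Metric.ball (0 : E) (1 + δ / 2)) := measure_mono hsub
      _ = _ := by simp only [μ.addHaar_ball_of_pos _ (show 0 < 1 + δ / 2 by positivity)]
  have J : (s.card : ENNReal) * ENNReal.ofReal ((δ / 2) ^ Module.finrank ℝ E) ≤
      ENNReal.ofReal ((1 + δ / 2) ^ Module.finrank ℝ E) :=
    (ENNReal.mul_le_mul_iff_left (Metric.measure_ball_pos _ _ zero_lt_one).ne'
      measure_ball_lt_top.ne).1 I
  have K := ENNReal.toReal_le_of_le_ofReal (by positivity) J
  rw [ENNReal.toReal_mul, ENNReal.toReal_ofReal (by positivity), ENNReal.toReal_natCast] at K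
  have e : 1 + 2 / δ = (1 + δ / 2) / (δ / 2) := by field_simp; ring
  rw [e, div_pow]
  exact (le_div_iff₀ (by positivity)).2 K

/-- A δ-separated set of greatest cardinality is a net, since an uncovered point could be added to
it. The packing bound ensures that a greatest cardinality exists. -/
theorem exists_net_unit_ball {δ : ℝ} (hδ : 0 < δ) :
    ∃ N : Finset E, (∀ v ∈ N, ‖v‖ ≤ 1) ∧ (N.card : ℝ) ≤ (1 + 2 / δ) ^ Module.finrank ℝ E ∧
      ∀ w : E, ‖w‖ ≤ 1 → ∃ v ∈ N, ‖w - v‖ < δ := by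
  classical
  let Q : ℕ → Prop := fun k => ∃ N : Finset E, (∀ v ∈ N, ‖v‖ ≤ 1) ∧
    (∀ c ∈ N, ∀ d ∈ N, c ≠ d → δ ≤ ‖c - d‖) ∧ N.card = k
  have hQ0 : Q 0 := ⟨∅, by simp, by simp, rfl⟩
  have hQb : ∀ k, Q k → k ≤ ⌊(1 + 2 / δ) ^ Module.finrank ℝ E⌋₊ := by
    rintro k ⟨N, h1, h2, rfl⟩
    exact Nat.le_floor (card_le_of_separated_unit_ball hδ N h1 h2)
  obtain ⟨N, h1, h2, h3⟩ := Nat.findGreatest_spec (P := Q) (Nat.zero_le _) hQ0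
  refine ⟨N, h1, card_le_of_separated_unit_ball hδ N h1 h2, fun w hw => ?_⟩
  by_contra! hcon
  have hwN : w ∉ N := fun hmem => by
    have := hcon w hmem
    simp at this
    linarith
  have hQ : Q (N.card + 1) := by
    refine ⟨insert w N, ?_, ?_, Finset.card_insert_of_notMem hwN⟩
    · intro v hv
      rcases Finset.mem_insert.1 hv with rfl | hv
      · exact hw
      · exact h1 v hv
    · intro c hc d hd hcd
      rcases Finset.mem_insert.1 hc with rfl | hc' <;> rcases Finset.mem_insert.1 hd with rfl | hd'
      · exact absurd rfl hcd
      · exact hcon d hd'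
      · rw [norm_sub_rev]; exact hcon c hc'
      · exact h2 c hc' d hd' hcd
  have h4 : N.card + 1 ≤ N.card := (Nat.le_findGreatest (hQb _ hQ) hQ).trans_eq h3.symm
  exact absurd h4 (by simp)

end Net

/-! ### Quartic forms: Lipschitz bounds and passage from a net to the ball. -/

/-- Continuous functions that are homogeneous of degree four and restrict to polynomials of degree
at most four on every line. -/
structure IsQuarticForm {E : Type*} [NormedAddCommGroup E] [NormedSpace ℝ E] (T : E → ℝ) : Prop where
  continuous : Continuous T
  map_smul : ∀ (c : ℝ) (v : E), T (c • v) = c ^ 4 * T v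
  line : ∀ v h : E, ∃ a₀ a₁ a₂ a₃ a₄ : ℝ, ∀ s : ℝ,
    T (v + s • h) = a₀ + a₁ * s + a₂ * s ^ 2 + a₃ * s ^ 3 + a₄ * s ^ 4

namespace IsQuarticForm

section

variable {E : Type*} [NormedAddCommGroup E] [NormedSpace ℝ E] {T T' : E → ℝ}

theorem add (h : IsQuarticForm T) (h' : IsQuarticForm T') : IsQuarticForm fun v => T v + T' v where
  continuous := h.continuous.add h'.continuous
  map_smul c v := by rw [h.map_smul, h'.map_smul]; ring
  line v u := by
    obtain ⟨a₀, a₁, a₂, a₃, a₄, ha⟩ := h.line v u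
    obtain ⟨b₀, b₁, b₂, b₃, b₄, hb⟩ := h'.line v u
    exact ⟨a₀ + b₀, a₁ + b₁, a₂ + b₂, a₃ + b₃, a₄ + b₄, fun s => by rw [ha, hb]; ring⟩

theorem const_mul (h : IsQuarticForm T) (r : ℝ) : IsQuarticForm fun v => r * T v where
  continuous := h.continuous.const_mul r
  map_smul c v := by rw [h.map_smul]; ring
  line v u := by
    obtain ⟨a₀, a₁, a₂, a₃, a₄, ha⟩ := h.line v u
    exact ⟨r * a₀, r * a₁, r * a₂, r * a₃, r * a₄, fun s => by rw [ha]; ring⟩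

theorem sum {ι : Type*} {F : ι → E → ℝ} (hF : ∀ i, IsQuarticForm (F i)) (s : Finset ι) :
    IsQuarticForm fun v => ∑ i ∈ s, F i v := by
  classical
  induction s using Finset.induction_on with
  | empty => exact ⟨by simp [continuous_const], by simp, fun _ _ => ⟨0, 0, 0, 0, 0, by simp⟩⟩
  | insert a s ha ih => simpa [Finset.sum_insert ha] using (hF a).add ih

theorem linear_pow_four (f : E →L[ℝ] ℝ) : IsQuarticForm fun v => f v ^ 4 where
  continuous := f.continuous.pow 4
  map_smul c v := by simp [mul_pow]
  line v u := ⟨f v ^ 4, 4 * f v ^ 3 * f u, 6 * f v ^ 2 * f u ^ 2, 4 * f v * f u ^ 3, f u ^ 4,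
    fun s => by simp; ring⟩

/-- Lipschitz bound on the unit ball. -/
theorem abs_sub_le (hT : IsQuarticForm T) {M : ℝ} (hM : ∀ v, ‖v‖ ≤ 1 → |T v| ≤ M) {v w : E}
    (hv : ‖v‖ ≤ 1) (hw : ‖w‖ ≤ 1) : |T w - T v| ≤ 1000 * M * ‖w - v‖ := by
  have hM0 : 0 ≤ M := (abs_nonneg _).trans (hM v hv)
  rcases eq_or_lt_of_le (norm_nonneg (w - v)) with h0 | hpos
  · have : w = v := sub_eq_zero.1 (norm_eq_zero.1 h0.symm)
    simp [this]
  set r := ‖w - v‖ with hr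
  rcases le_or_gt 1 r with h1 | h1
  · have e1 := hM v hv
    have e2 := hM w hw
    calc |T w - T v| ≤ |T w| + |T v| := abs_sub _ _
      _ ≤ 1000 * M * 1 := by linarith
      _ ≤ 1000 * M * r := by gcongr
  set h := r⁻¹ • (w - v) with hh
  have hnorm : ‖h‖ = 1 := by
    rw [hh, norm_smul, norm_inv, norm_norm]
    exact inv_mul_cancel₀ hpos.ne'
  obtain ⟨a₀, a₁, a₂, a₃, a₄, ha⟩ := hT.line v h
  -- These points lie in the ball of radius 2; halving them and using homogeneity costs 2⁴.
  have hbd : ∀ s : ℝ, |s| ≤ 1 → |T (v + s • h)| ≤ 16 * M := by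
    intro s hs
    have hn : ‖(1 / 2 : ℝ) • (v + s • h)‖ ≤ 1 := by
      rw [norm_smul]
      have : ‖v + s • h‖ ≤ 2 := by
        calc _ ≤ ‖v‖ + ‖s • h‖ := norm_add_le _ _
          _ ≤ 1 + 1 := by
            rw [norm_smul, hnorm, mul_one]
            exact add_le_add hv hs
          _ = 2 := by norm_num
      norm_num
      linarith
    have := hM _ hn
    rw [hT.map_smul, abs_mul, abs_of_pos (by norm_num : (0 : ℝ) < (1 / 2) ^ 4)] at this
    linarith
  have hw' : T w = T (v + r • h) := by
    congr 1
    rw [hh, smul_smul, mul_inv_cancel₀ hpos.ne', one_smul]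
    abel
  have hv' : T v = a₀ := by simpa using ha 0
  -- A quartic polynomial is determined by its values at 0, ±1, ±1/2, so bounds at these five points
  -- bound every coefficient.
  have b0 := hbd 0 (by simp)
  have b1 := hbd 1 (by simp)
  have b2 := hbd (-1) (by simp)
  have b3 := hbd (1 / 2) (by norm_num [abs_of_pos])
  have b4 := hbd (-(1 / 2)) (by norm_num [abs_of_pos])
  rw [ha, abs_le] at b0 b1 b2 b3 b4
  have c1 : |a₁| ≤ 100 * M := abs_le.2 ⟨by linarith, by linarith⟩
  have c2 : |a₂| ≤ 300 * M := abs_le.2 ⟨by linarith, by linarith⟩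
  have c3 : |a₃| ≤ 100 * M := abs_le.2 ⟨by linarith, by linarith⟩
  have c4 : |a₄| ≤ 300 * M := abs_le.2 ⟨by linarith, by linarith⟩
  have key : T w - T v = (a₁ + a₂ * r + a₃ * r ^ 2 + a₄ * r ^ 3) * r := by
    rw [hw', ha, hv']; ring
  rw [key, abs_mul, abs_of_pos hpos]
  refine mul_le_mul_of_nonneg_right ?_ hpos.le
  have t : ∀ (a : ℝ) (k : ℕ), |a * r ^ k| ≤ |a| := fun a k => by
    rw [abs_mul, abs_of_nonneg (pow_nonneg hpos.le k)]
    exact mul_le_of_le_one_right (abs_nonneg a) (pow_le_one₀ hpos.le h1.le)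
  have t1 := t a₂ 1
  have t2 := t a₃ 2
  have t3 := t a₄ 3
  rw [pow_one] at t1
  calc _ ≤ |a₁| + |a₂ * r| + |a₃ * r ^ 2| + |a₄ * r ^ 3| :=
        (abs_add_le _ _).trans (by gcongr; exact (abs_add_le _ _).trans (by gcongr; exact abs_add_le _ _))
    _ ≤ 1000 * M := by linarith

end

/-- The supremum of a quartic form over the unit ball is controlled by its values on a net. -/
theorem abs_le_of_net {E : Type*} [NormedAddCommGroup E] [NormedSpace ℝ E] [FiniteDimensional ℝ E]
    {T : E → ℝ} (hT : IsQuarticForm T) {N : Finset E} (hN : ∀ v ∈ N, ‖v‖ ≤ 1)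
    (hcov : ∀ w : E, ‖w‖ ≤ 1 → ∃ v ∈ N, ‖w - v‖ < 1 / 2000) {S : ℝ}
    (hS : ∀ v ∈ N, |T v| ≤ S) {w : E} (hw : ‖w‖ ≤ 1) : |T w| ≤ 2 * S := by
  -- The passage from the net costs a factor 2: the Lipschitz constant 1000|T z| times the mesh
  -- 1/2000 is half of the maximum |T z|, which is absorbed on the left.
  have := FiniteDimensional.proper_real E
  obtain ⟨z, hz, hmax⟩ := (isCompact_closedBall (0 : E) 1).exists_isMaxOn
    ⟨0, by simp⟩ (hT.continuous.abs.continuousOn)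
  have hz1 : ‖z‖ ≤ 1 := by simpa using hz
  have hmax' : ∀ v : E, ‖v‖ ≤ 1 → |T v| ≤ |T z| := fun v hv => hmax (by simpa using hv)
  obtain ⟨v, hv, hd⟩ := hcov z hz1
  have h1 := hT.abs_sub_le hmax' (hN v hv) hz1
  have h2 : |T z| ≤ |T z - T v| + |T v| := by
    calc |T z| = |(T z - T v) + T v| := by ring_nf
      _ ≤ _ := abs_add_le _ _
  have h3 := hS v hv
  have h4 : 1000 * |T z| * ‖z - v‖ ≤ 1000 * |T z| * (1 / 2000) := by gcongr
  linarith [hmax' w hw]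

end IsQuarticForm

/-- Independence of the columns of a matrix with independent entries. -/
theorem iIndepFun_columns {Ω ι κ : Type*} [Finite ι] [Finite κ] [MeasurableSpace Ω] {μ : Measure Ω}
    {X : ι → κ → Ω → ℝ} (hm : ∀ i j, AEMeasurable (X i j) μ)
    (h : iIndepFun (fun (ij : ι × κ) ω => X ij.1 ij.2 ω) μ) :
    iIndepFun (fun j ω i => X i j ω) μ := by
  have := h.isProbabilityMeasure
  have hprob : ∀ i j, IsProbabilityMeasure (μ.map (X i j)) := fun i j =>
    Measure.isProbabilityMeasure_map (hm i j)
  have hsig : iIndepFun (fun (p : (_ : κ) × ι) ω => X p.2 p.1 ω) μ :=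
    h.precomp (g := fun p : (_ : κ) × ι => (p.2, p.1)) fun a b hab => by
      cases a; cases b; simp at hab; simp [hab]
  have hcol : ∀ j, iIndepFun (fun i ω => X i j ω) μ := fun j =>
    h.precomp (g := fun i => (i, j)) fun a b hab => by simpa using hab
  rw [iIndepFun_iff_map_fun_eq_infinitePi_map₀' (fun j => by fun_prop)]
  have e1 := (iIndepFun_iff_map_fun_eq_infinitePi_map₀'
    (fun p : (_ : κ) × ι => hm p.2 p.1)).1 hsig
  have e2 := fun j => (iIndepFun_iff_map_fun_eq_infinitePi_map₀' (fun i => hm i j)).1 (hcol j)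
  -- Under currying, the product law of all entries becomes a product over columns of product laws,
  -- and each factor is the law of a column.
  have e3 : (fun ω j i => X i j ω) =
      (MeasurableEquiv.piCurry fun (_ : κ) (_ : ι) => ℝ) ∘ (fun ω (p : (_ : κ) × ι) => X p.2 p.1 ω) := by
    ext; simp [Sigma.curry]
  rw [e3, ← AEMeasurable.map_map_of_aemeasurable (by fun_prop) (by fun_prop), e1,
    Measure.infinitePi_map_piCurry (fun j i => μ.map (X i j))]
  congr 1
  funext j
  exact (e2 j).symm

/-! ### Uniform concentration of the empirical fourth moment. -/

section Deviation

variable {n p : ℕ}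

/-- The deviation of the empirical fourth moment of the columns of `X` in direction `w` from
its expectation. -/
noncomputable def fourthMomentDeviation (θ : ℝ) (X : Matrix (Fin n) (Fin p) ℝ)
    (w : EuclideanSpace ℝ (Fin n)) : ℝ :=
  (1 / p) * ∑ j, (∑ k, w k * X k j) ^ 4 +
    (-1) * (3 * θ * (1 - θ) * ∑ k, w k ^ 4 + 3 * θ ^ 2 * (∑ k, w k ^ 2) ^ 2)

theorem isQuarticForm_sq_sum_sq :
    IsQuarticForm fun w : EuclideanSpace ℝ (Fin n) => (∑ k, w k ^ 2) ^ 2 where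
  continuous := by fun_prop
  map_smul c v := by
    simp only [PiLp.smul_apply, smul_eq_mul, mul_pow, ← Finset.mul_sum]
    ring
  line v u := by
    refine ⟨(∑ k, v k ^ 2) ^ 2, 4 * (∑ k, v k ^ 2) * (∑ k, v k * u k),
      2 * (∑ k, v k ^ 2) * (∑ k, u k ^ 2) + 4 * (∑ k, v k * u k) ^ 2,
      4 * (∑ k, v k * u k) * (∑ k, u k ^ 2), (∑ k, u k ^ 2) ^ 2, fun s => ?_⟩
    have : ∑ k, (v + s • u) k ^ 2 =
        ∑ k, v k ^ 2 + 2 * s * ∑ k, v k * u k + s ^ 2 * ∑ k, u k ^ 2 := by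
      rw [Finset.mul_sum, Finset.mul_sum, ← Finset.sum_add_distrib, ← Finset.sum_add_distrib]
      refine Finset.sum_congr rfl fun k _ => ?_
      simp only [PiLp.add_apply, PiLp.smul_apply, smul_eq_mul]
      ring
    rw [this]
    ring

/-- Writing the deviation with `(-1) *` instead of a subtraction reduces this to the closure rules
`add`, `const_mul` and `sum`. -/
theorem isQuarticForm_fourthMomentDeviation (θ : ℝ) (X : Matrix (Fin n) (Fin p) ℝ) :
    IsQuarticForm (fourthMomentDeviation θ X) := by
  have h1 : ∀ j, IsQuarticForm
      fun w : EuclideanSpace ℝ (Fin n) => (∑ k, w k * X k j) ^ 4 := by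
    intro j
    let f : EuclideanSpace ℝ (Fin n) →L[ℝ] ℝ := ∑ k, X k j • EuclideanSpace.proj k
    have := IsQuarticForm.linear_pow_four f
    simpa [f, mul_comm] using this
  have h2 : ∀ k, IsQuarticForm fun w : EuclideanSpace ℝ (Fin n) => w k ^ 4 := fun k =>
    IsQuarticForm.linear_pow_four (EuclideanSpace.proj k)
  exact ((IsQuarticForm.sum h1 Finset.univ).const_mul _).add
    ((((IsQuarticForm.sum h2 Finset.univ).const_mul _).add
      (isQuarticForm_sq_sum_sq.const_mul _)).const_mul (-1))

/-- A choice of the Chernoff parameter for Bernstein-type tails. -/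
theorem exists_chernoff_parameter {m P S : ℝ} (hm : 0 < m) (hP : 0 < P) (hS : 0 < S)
    (h1 : 2112 * m ^ 2 ≤ P * S) (h2 : 4400000 * m ≤ P * S ^ 2) :
    ∃ s : ℝ, 0 ≤ s ∧ s * (12 * m) ≤ 1 / 8 ∧ -s * (P * S) + P * (98304 * s ^ 2) ≤ -(11 * m) := by
  -- The unconstrained minimiser of -sS + 98304 s² is S/196608, while the truncation constraint
  -- reads s ≤ 1/(96m). The smaller of the two is used; `h1` serves the constrained case and `h2`
  -- the unconstrained one.
  rcases le_total (1 / (96 * m)) (S / 196608) with h | h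
  · refine ⟨1 / (96 * m), by positivity, by field_simp; norm_num, ?_⟩
    have e1 : P * (98304 * (1 / (96 * m)) ^ 2) ≤ P * (98304 * (1 / (96 * m) * (S / 196608))) := by
      rw [sq]; gcongr
    have e2 : 11 * m ≤ 1 / (96 * m) * (P * S) / 2 := by
      rw [div_mul_eq_mul_div, one_mul, div_div, le_div_iff₀ (by positivity)]
      nlinarith
    linarith
  · refine ⟨S / 196608, by positivity, ?_, ?_⟩
    · calc S / 196608 * (12 * m) ≤ 1 / (96 * m) * (12 * m) := by gcongr
        _ ≤ 1 / 8 := by field_simp; norm_num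
    · nlinarith

section Tail

variable {Ω : Type*} [MeasurableSpace Ω] {μ : Measure Ω}
  {θ : unitInterval} {X : Ω → Matrix (Fin n) (Fin p) ℝ}

theorem IsBernoulliGaussianMatrix.iIndepFun_columns (hX : IsBernoulliGaussianMatrix μ θ X) :
    iIndepFun (fun j ω i => X ω i j) μ :=
  _root_.iIndepFun_columns (X := fun i j ω => X ω i j) (fun i j => (hX.hasLaw i j).aemeasurable)
    hX.indep

theorem IsBernoulliGaussianMatrix.iIndepFun_column (hX : IsBernoulliGaussianMatrix μ θ X)
    (j : Fin p) : iIndepFun (fun i ω => X ω i j) μ :=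
  hX.indep.precomp (g := fun i => (i, j)) fun a b hab => by simpa using hab

theorem IsBernoulliGaussianMatrix.hasSubgaussianMGF_linearForm [IsProbabilityMeasure μ]
    (hX : IsBernoulliGaussianMatrix μ θ X) (w : Fin n → ℝ) (j : Fin p) :
    HasSubgaussianMGF (fun ω => ∑ k, w k * X ω k j) (∑ k, (w k ^ 2).toNNReal) μ :=
  _root_.hasSubgaussianMGF_linearForm (fun k => hX.hasLaw k j) (hX.iIndepFun_column j) w Finset.univ

theorem sum_toNNReal_sq_le_one {w : Fin n → ℝ} (hw : ∑ k, w k ^ 2 ≤ 1) :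
    ∑ k, (w k ^ 2).toNNReal ≤ 1 := by
  rw [← NNReal.coe_le_coe, NNReal.coe_sum]
  simpa [Real.coe_toNNReal _ (sq_nonneg _)] using hw

theorem IsBernoulliGaussianMatrix.aemeasurable_column (hX : IsBernoulliGaussianMatrix μ θ X)
    (j : Fin p) : AEMeasurable (fun ω i => X ω i j) μ :=
  aemeasurable_pi_lambda _ fun i => (hX.hasLaw i j).aemeasurable

/-- The fourth power of the linear form `w`, cut off where the squared norm exceeds `B`. -/
noncomputable def truncatedPowFour (B : ℝ) (w x : Fin n → ℝ) : ℝ :=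
  if ∑ k, x k ^ 2 ≤ B then (∑ k, w k * x k) ^ 4 else 0

theorem measurable_truncatedPowFour (B : ℝ) (w : Fin n → ℝ) :
    Measurable (truncatedPowFour B w) := by
  refine Measurable.ite (measurableSet_le (by fun_prop) (by fun_prop)) (by fun_prop) (by fun_prop)

theorem truncatedPowFour_nonneg (B : ℝ) (w x : Fin n → ℝ) : 0 ≤ truncatedPowFour B w x := by
  unfold truncatedPowFour; split_ifs <;> positivity

theorem truncatedPowFour_le (B : ℝ) (w x : Fin n → ℝ) :
    truncatedPowFour B w x ≤ (∑ k, w k * x k) ^ 4 := by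
  unfold truncatedPowFour; split_ifs
  · exact le_rfl
  · positivity

/-- Cauchy–Schwarz. The cutoff depends on the column alone and not on `w`, so a single event per
column removes the truncation for all directions at once. -/
theorem truncatedPowFour_le_mul_sq {B : ℝ} (hB : 0 ≤ B) {w : Fin n → ℝ} (hw : ∑ k, w k ^ 2 ≤ 1)
    (x : Fin n → ℝ) : truncatedPowFour B w x ≤ B * (∑ k, w k * x k) ^ 2 := by
  unfold truncatedPowFour; split_ifs with h
  · have h1 := Finset.sum_mul_sq_le_sq_mul_sq Finset.univ w x
    have h2 : (∑ k, w k ^ 2) * ∑ k, x k ^ 2 ≤ 1 * B :=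
      mul_le_mul hw h (Finset.sum_nonneg fun _ _ => sq_nonneg _) zero_le_one
    nlinarith [sq_nonneg (∑ k, w k * x k)]
  · positivity

theorem integral_linearForm_pow_four [IsProbabilityMeasure μ]
    (hX : IsBernoulliGaussianMatrix μ θ X) (w : Fin n → ℝ)
    (j : Fin p) : ∫ ω, (∑ k, w k * X ω k j) ^ 4 ∂μ =
      3 * θ * (1 - θ) * ∑ k, w k ^ 4 + 3 * θ ^ 2 * (∑ k, w k ^ 2) ^ 2 :=
  (moments_linearForm (fun k => hX.hasLaw k j) (hX.iIndepFun_column j) w Finset.univ).2.2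

/-- The centring is at the mean of the untruncated power: truncation only lowers the variable, so
the upper tail bound survives. -/
theorem measureReal_truncated_sum_ge_le [IsProbabilityMeasure μ]
    (hX : IsBernoulliGaussianMatrix μ θ X) {w : Fin n → ℝ}
    (hw : ∑ k, w k ^ 2 ≤ 1) {B s : ℝ} (hB : 0 ≤ B) (hs : 0 ≤ s) (hsB : s * B ≤ 1 / 8) (t : ℝ) :
    μ.real {ω | t ≤ ∑ j, (truncatedPowFour B w (fun i => X ω i j) -
      (3 * θ * (1 - θ) * ∑ k, w k ^ 4 + 3 * θ ^ 2 * (∑ k, w k ^ 2) ^ 2))} ≤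
      Real.exp (-s * t + p * (98304 * s ^ 2)) := by
  have hind := hX.iIndepFun_columns.comp (fun _ x => truncatedPowFour B w x -
      (3 * θ * (1 - θ) * ∑ k, w k ^ 4 + 3 * θ ^ 2 * (∑ k, w k ^ 2) ^ 2))
      fun _ => (measurable_truncatedPowFour B w).sub_const _
  have hξ : ∀ j, AEMeasurable (fun ω => truncatedPowFour B w fun i => X ω i j) μ := fun j =>
    (measurable_truncatedPowFour B w).comp_aemeasurable (hX.aemeasurable_column j)
  have key := fun j => mgf_truncated_pow_four_sub_le (hX.hasSubgaussianMGF_linearForm w j)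
    (sum_toNNReal_sq_le_one hw) (hξ j) (fun ω => truncatedPowFour_nonneg B w _)
    (fun ω => truncatedPowFour_le B w _) (fun ω => truncatedPowFour_le_mul_sq hB hw _) hs hsB
  simp_rw [integral_linearForm_pow_four hX] at key
  have := measureReal_sum_ge_le_of_mgf_le hind (fun j => (hξ j).sub_const _) hs
    (fun j => (key j).1) (fun j => (key j).2) t
  simpa using this

theorem measureReal_sum_lower_le [IsProbabilityMeasure μ]
    (hX : IsBernoulliGaussianMatrix μ θ X) {w : Fin n → ℝ}
    (hw : ∑ k, w k ^ 2 ≤ 1) {s : ℝ} (hs : 0 ≤ s) (t : ℝ) :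
    μ.real {ω | t ≤ ∑ j, ((3 * θ * (1 - θ) * ∑ k, w k ^ 4 + 3 * θ ^ 2 * (∑ k, w k ^ 2) ^ 2) -
      (∑ k, w k * X ω k j) ^ 4)} ≤
      Real.exp (-s * t + p * (98304 * s ^ 2)) := by
  have hind := hX.iIndepFun_columns.comp (fun _ x =>
      (3 * θ * (1 - θ) * ∑ k, w k ^ 4 + 3 * θ ^ 2 * (∑ k, w k ^ 2) ^ 2) - (∑ k, w k * x k) ^ 4)
      fun _ => by fun_prop
  have hy := fun j => hX.hasSubgaussianMGF_linearForm w j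
  have key := fun j => mgf_sub_pow_four_le (hy j) (sum_toNNReal_sq_le_one hw) hs
  simp_rw [integral_linearForm_pow_four hX] at key
  have := measureReal_sum_ge_le_of_mgf_le hind
    (fun j => ((hy j).aemeasurable.pow_const 4).const_sub _) hs
    (fun j => (key j).1) (fun j => (key j).2) t
  simpa using this

theorem measureReal_sum_sq_column_ge_le [IsProbabilityMeasure μ]
    (hX : IsBernoulliGaussianMatrix μ θ X) (j : Fin p)
    (t : ℝ) : μ.real {ω | t ≤ ∑ k, X ω k j ^ 2} ≤ Real.exp (-(t / 4) + n) := by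
  have hind := (hX.iIndepFun_column j).comp (fun _ x => x ^ 2) fun _ => by fun_prop
  have hsub := fun k => integral_exp_sq_le_of_hasSubgaussianMGF
    (hasSubgaussianMGF_of_hasLaw_bernoulliGaussian (hX.hasLaw k j)) le_rfl
  have e : ∀ x : ℝ, x ^ 2 / 4 = 1 / 4 * x ^ 2 := fun x => by ring
  simp_rw [e] at hsub
  have h2 : (2 : ℝ) ≤ Real.exp 1 := by linarith [Real.add_one_le_exp (1 : ℝ)]
  have := measureReal_sum_ge_le_of_mgf_le hind
    (fun k => (hX.hasLaw k j).aemeasurable.pow_const 2) (s := 1 / 4) (K := 1) (by norm_num)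
    (fun k => (hsub k).1) (fun k => (hsub k).2.trans h2) t
  refine this.trans_eq ?_
  congr 1
  simp
  ring

/-- With high probability the deviation of the fourth moment is uniformly small over the unit
ball. -/
theorem measureReal_fourthMomentDeviation_le [IsProbabilityMeasure μ]
    (hX : IsBernoulliGaussianMatrix μ θ X)
    (hn : 1 ≤ n) (hp : 1 ≤ p) {S : ℝ} (hS : 0 < S)
    (h1 : 2112 * (n + Real.log p) ^ 2 ≤ p * S) (h2 : 4400000 * (n + Real.log p) ≤ p * S ^ 2) :
    μ.real {ω | ¬ ∀ w : EuclideanSpace ℝ (Fin n), ‖w‖ ≤ 1 →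
      |fourthMomentDeviation θ (X ω) w| ≤ 2 * S} ≤ 1 / p := by
  have hp' : (1 : ℝ) ≤ p := by exact_mod_cast hp
  have hn' : (1 : ℝ) ≤ n := by exact_mod_cast hn
  have hlog : 0 ≤ Real.log p := Real.log_nonneg hp'
  set m : ℝ := n + Real.log p with hm
  have hm0 : 0 < m := by linarith
  obtain ⟨s, hs0, hsB, hsexp⟩ := exists_chernoff_parameter hm0 (by linarith : (0 : ℝ) < p) hS h1 h2
  obtain ⟨N, hN1, hNc, hNcov⟩ := exists_net_unit_ball (E := EuclideanSpace ℝ (Fin n))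
    (δ := 1 / 2000) (by norm_num)
  have hNw : ∀ v ∈ N, ∑ k, v k ^ 2 ≤ 1 := fun v hv => by
    rw [← EuclideanSpace.real_norm_sq_eq]
    exact pow_le_one₀ (norm_nonneg _) (hN1 v hv)
  let U : EuclideanSpace ℝ (Fin n) → Set Ω := fun w =>
    {ω | p * S ≤ ∑ j, (truncatedPowFour (12 * m) w (fun i => X ω i j) -
      (3 * θ * (1 - θ) * ∑ k, w k ^ 4 + 3 * θ ^ 2 * (∑ k, w k ^ 2) ^ 2))}
  let L : EuclideanSpace ℝ (Fin n) → Set Ω := fun w =>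
    {ω | p * S ≤ ∑ j, ((3 * θ * (1 - θ) * ∑ k, w k ^ 4 + 3 * θ ^ 2 * (∑ k, w k ^ 2) ^ 2) -
      (∑ k, w k * X ω k j) ^ 4)}
  let R : Fin p → Set Ω := fun j => {ω | 12 * m ≤ ∑ k, X ω k j ^ 2}
  have hsub : {ω | ¬ ∀ w : EuclideanSpace ℝ (Fin n), ‖w‖ ≤ 1 →
      |fourthMomentDeviation θ (X ω) w| ≤ 2 * S} ⊆
      ((⋃ v ∈ N, U v) ∪ ⋃ v ∈ N, L v) ∪ ⋃ j ∈ Finset.univ, R j := by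
    intro ω hω
    by_contra hcon
    simp only [Set.mem_union, Set.mem_iUnion, not_or, not_exists, Finset.mem_univ] at hcon
    obtain ⟨⟨hU, hL⟩, hR⟩ := hcon
    refine hω fun w hw => (isQuarticForm_fourthMomentDeviation θ (X ω)).abs_le_of_net hN1 hNcov
      (fun v hv => ?_) hw
    have hu := hU v hv
    have hl := hL v hv
    simp only [U, L, Set.mem_ofPred_eq, not_le, Finset.sum_sub_distrib, Finset.sum_const,
      Finset.card_univ, Fintype.card_fin, nsmul_eq_mul] at hu hl
    -- Off the events `R j` no column is cut off, so the truncated sums are the true ones.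
    have htr : ∀ j, truncatedPowFour (12 * m) v (fun i => X ω i j) = (∑ k, v k * X ω k j) ^ 4 := by
      intro j
      have := hR j trivial
      simp only [R, Set.mem_ofPred_eq, not_le] at this
      exact if_pos this.le
    simp_rw [htr] at hu
    have hdev : p * fourthMomentDeviation θ (X ω) v = ∑ j, (∑ k, v k * X ω k j) ^ 4 -
        p * (3 * θ * (1 - θ) * ∑ k, v k ^ 4 + 3 * θ ^ 2 * (∑ k, v k ^ 2) ^ 2) := by
      unfold fourthMomentDeviation
      field_simp
      ring
    refine abs_le.2 ⟨?_, ?_⟩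
    · refine le_of_mul_le_mul_left ?_ (by linarith : (0 : ℝ) < p)
      linarith
    · refine le_of_mul_le_mul_left ?_ (by linarith : (0 : ℝ) < p)
      linarith
  have hUb : ∀ v ∈ N, μ.real (U v) ≤ Real.exp (-(11 * m)) := fun v hv =>
    (measureReal_truncated_sum_ge_le hX (hNw v hv) (by positivity) hs0 hsB _).trans
      (Real.exp_le_exp.2 hsexp)
  have hLb : ∀ v ∈ N, μ.real (L v) ≤ Real.exp (-(11 * m)) := fun v hv =>
    (measureReal_sum_lower_le hX (hNw v hv) hs0 _).trans (Real.exp_le_exp.2 hsexp)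
  have hRb : ∀ j, μ.real (R j) ≤ Real.exp (-(3 * m) + n) := fun j =>
    (measureReal_sum_sq_column_ge_le hX j _).trans (Real.exp_le_exp.2 (by linarith))
  -- The mesh 1/2000 gives at most 4001ⁿ points, and 4001 ≤ e⁹. The exponent 11m in the tails beats
  -- this entropy with 2n + log p to spare.
  have hNe : (N.card : ℝ) ≤ Real.exp (9 * n) := by
    refine hNc.trans ?_
    rw [finrank_euclideanSpace_fin, mul_comm, Real.exp_nat_mul]
    refine pow_le_pow_left₀ (by norm_num) ?_ _
    have h9 : Real.exp 9 = Real.exp 1 ^ 9 := by rw [← Real.exp_nat_mul]; norm_num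
    rw [h9]
    calc (1 + 2 / (1 / 2000) : ℝ) ≤ 2.7 ^ 9 := by norm_num
      _ ≤ Real.exp 1 ^ 9 := by
        gcongr
        linarith [Real.exp_one_gt_d9]
  have hplog : (p : ℝ) = Real.exp (Real.log p) := (Real.exp_log (by linarith)).symm
  calc _ ≤ μ.real (((⋃ v ∈ N, U v) ∪ ⋃ v ∈ N, L v) ∪ ⋃ j ∈ Finset.univ, R j) :=
        measureReal_mono hsub
    _ ≤ μ.real (⋃ v ∈ N, U v) + μ.real (⋃ v ∈ N, L v) + μ.real (⋃ j ∈ Finset.univ, R j) :=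
        (measureReal_union_le _ _).trans (by gcongr; exact measureReal_union_le _ _)
    _ ≤ ∑ v ∈ N, μ.real (U v) + ∑ v ∈ N, μ.real (L v) + ∑ j, μ.real (R j) := by
        gcongr <;> exact measureReal_biUnion_finset_le _ _
    _ ≤ ∑ _v ∈ N, Real.exp (-(11 * m)) + ∑ _v ∈ N, Real.exp (-(11 * m)) +
          ∑ _j : Fin p, Real.exp (-(3 * m) + n) := by
        gcongr with v hv v hv j _
        · exact hUb v hv
        · exact hLb v hv
        · exact hRb j
    _ = N.card * Real.exp (-(11 * m)) + N.card * Real.exp (-(11 * m)) +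
          p * Real.exp (-(3 * m) + n) := by simp
    _ ≤ Real.exp (9 * n) * Real.exp (-(11 * m)) + Real.exp (9 * n) * Real.exp (-(11 * m)) +
          Real.exp (Real.log p) * Real.exp (-(3 * m) + n) := by
        rw [← hplog]; gcongr
    _ ≤ 3 * Real.exp (-(2 * n) - Real.log p) := by
        simp only [← Real.exp_add]
        have a1 : Real.exp (9 * n + -(11 * m)) ≤ Real.exp (-(2 * n) - Real.log p) :=
          Real.exp_le_exp.2 (by rw [hm]; linarith)
        have a2 : Real.exp (Real.log p + (-(3 * m) + n)) ≤ Real.exp (-(2 * n) - Real.log p) :=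
          Real.exp_le_exp.2 (by rw [hm]; linarith)
        linarith
    _ ≤ 1 / p := by
        rw [sub_eq_add_neg, Real.exp_add, Real.exp_neg (Real.log p), ← hplog, one_div, ← mul_assoc]
        refine mul_le_of_le_one_left (by positivity) ?_
        rw [Real.exp_neg, ← div_eq_mul_inv, div_le_one (Real.exp_pos _)]
        -- The three terms of the union bound are paid for by exp(2n) ≥ 2n + 1 ≥ 3, where n ≥ 1
        -- enters.
        linarith [Real.add_one_le_exp (2 * n : ℝ)]

end Tail

end Deviation

/-! ### Stability of the ℓ⁴ maximum on the orthogonal group. -/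

section Deterministic

variable {n p : ℕ}

theorem sum_row_sq_of_mem_orthogonalGroup {W : Matrix (Fin n) (Fin n) ℝ}
    (hW : W ∈ Matrix.orthogonalGroup (Fin n) ℝ) (i : Fin n) : ∑ k, W i k ^ 2 = 1 := by
  have h := congrFun (congrFun ((Matrix.mem_orthogonalGroup_iff _ _).1 hW) i) i
  simpa [Matrix.mul_apply, Matrix.star_apply, sq] using h

theorem sum_col_sq_of_mem_orthogonalGroup {W : Matrix (Fin n) (Fin n) ℝ}
    (hW : W ∈ Matrix.orthogonalGroup (Fin n) ℝ) (k : Fin n) : ∑ i, W i k ^ 2 = 1 := by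
  have h := congrFun (congrFun ((Matrix.mem_orthogonalGroup_iff' _ _).1 hW) k) k
  simpa [Matrix.mul_apply, Matrix.star_apply, sq] using h

/-- The entrywise square of an orthogonal matrix puts weight at least its `ℓ⁴` mass on some
permutation. -/
theorem exists_perm_l4Pow_le {W : Matrix (Fin n) (Fin n) ℝ}
    (hW : W ∈ Matrix.orthogonalGroup (Fin n) ℝ) :
    ∃ σ : Equiv.Perm (Fin n), l4Pow W ≤ ∑ i, W i (σ i) ^ 2 := by
  have hM : (Matrix.of fun i j => W i j ^ 2) ∈ doublyStochastic ℝ (Fin n) := by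
    rw [mem_doublyStochastic_iff_sum]
    exact ⟨fun i j => sq_nonneg _, fun i => sum_row_sq_of_mem_orthogonalGroup hW i,
      fun j => sum_col_sq_of_mem_orthogonalGroup hW j⟩
  -- Birkhoff: the squared entries are a convex combination of permutation matrices. Replacing one
  -- factor of W_ij² · W_ij² by it shows that ‖W‖₄⁴ is an average over σ of ∑ᵢ W_iσ(i)², so some σ
  -- reaches the average.
  obtain ⟨c, hc0, hc1, hc⟩ := exists_eq_sum_perm_of_mem_doublyStochastic hM
  have hentry : ∀ i j, W i j ^ 2 = ∑ σ : Equiv.Perm (Fin n), c σ * (if σ i = j then 1 else 0) := by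
    intro i j
    have := congrFun (congrFun hc i) j
    simp only [Matrix.sum_apply, Matrix.smul_apply, smul_eq_mul, Matrix.of_apply] at this
    rw [← this]
    refine Finset.sum_congr rfl fun σ _ => ?_
    simp [Equiv.Perm.permMatrix, PEquiv.toMatrix_apply, Equiv.toPEquiv_apply, eq_comm]
  have hl4 : l4Pow W = ∑ σ : Equiv.Perm (Fin n), c σ * ∑ i, W i (σ i) ^ 2 := by
    have h1 : ∀ i j, W i j ^ 4 =
        ∑ σ : Equiv.Perm (Fin n), c σ * (if σ i = j then W i j ^ 2 else 0) := by
      intro i j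
      have : W i j ^ 4 = W i j ^ 2 * W i j ^ 2 := by ring
      rw [this]
      nth_rewrite 1 [hentry i j]
      rw [Finset.sum_mul]
      refine Finset.sum_congr rfl fun σ _ => ?_
      split_ifs <;> ring
    unfold l4Pow
    simp_rw [h1]
    calc _ = ∑ i, ∑ σ : Equiv.Perm (Fin n), ∑ j, c σ * (if σ i = j then W i j ^ 2 else 0) :=
          Finset.sum_congr rfl fun i _ => Finset.sum_comm
      _ = ∑ σ : Equiv.Perm (Fin n), ∑ i, ∑ j, c σ * (if σ i = j then W i j ^ 2 else 0) :=
          Finset.sum_comm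
      _ = _ := by
          refine Finset.sum_congr rfl fun σ _ => ?_
          rw [Finset.mul_sum]
          refine Finset.sum_congr rfl fun i _ => ?_
          rw [← Finset.mul_sum]
          simp
  by_contra! hcon
  have hz : ∑ σ, c σ * (l4Pow W - ∑ i, W i (σ i) ^ 2) = 0 := by
    simp_rw [mul_sub]
    rw [Finset.sum_sub_distrib, ← Finset.sum_mul, hc1, ← hl4]
    ring
  have hz' := (Finset.sum_eq_zero_iff_of_nonneg fun σ _ =>
    mul_nonneg (hc0 σ) (sub_nonneg.2 (hcon σ).le)).1 hz
  have : ∀ σ, c σ = 0 := fun σ => by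
    rcases mul_eq_zero.1 (hz' σ (Finset.mem_univ _)) with h | h
    · exact h
    · linarith [hcon σ]
  simp [this] at hc1

/-- An orthogonal matrix with large `ℓ⁴` norm is close to a signed permutation matrix. -/
theorem exists_isSignedPermutation_frobeniusSq_le {W : Matrix (Fin n) (Fin n) ℝ}
    (hW : W ∈ Matrix.orthogonalGroup (Fin n) ℝ) :
    ∃ P, IsSignedPermutation P ∧ frobeniusSq (W - P) ≤ 2 * (n - l4Pow W) := by
  obtain ⟨σ, hσ⟩ := exists_perm_l4Pow_le hW
  -- The sign of 0 is taken to be 1, so that `P` is orthogonal even if some selected entry vanishes.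
  let sg : ℝ → ℝ := fun x => if 0 ≤ x then 1 else -1
  have hsg2 : ∀ x, sg x ^ 2 = 1 := fun x => by simp only [sg]; split_ifs <;> norm_num
  have hsg : ∀ x, sg x * x = |x| := fun x => by
    simp only [sg]
    split_ifs with h
    · rw [abs_of_nonneg h, one_mul]
    · rw [abs_of_neg (not_le.1 h)]; ring
  let P : Matrix (Fin n) (Fin n) ℝ := Matrix.of fun i j => if σ i = j then sg (W i j) else 0
  refine ⟨P, ⟨?_, ?_⟩, ?_⟩
  · rw [Matrix.mem_orthogonalGroup_iff]
    ext i k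
    rw [Matrix.mul_apply]
    simp only [P, Matrix.of_apply, ite_mul, zero_mul,
      Finset.sum_ite_eq, Finset.mem_univ, if_true]
    rcases eq_or_ne i k with rfl | hik
    · simp [← sq, hsg2]
    · have : σ k ≠ σ i := fun h => hik (σ.injective h).symm
      simp [this, hik]
  · intro i j
    simp only [P, Matrix.of_apply, sg]
    split_ifs <;> simp
  · have hrow : ∀ i, ∑ j, (W - P) i j ^ 2 = 2 - 2 * |W i (σ i)| := by
      intro i
      have h1 : ∀ j, (W - P) i j ^ 2 = W i j ^ 2 + if σ i = j then 1 - 2 * |W i j| else 0 := by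
        intro j
        simp only [P, Matrix.sub_apply, Matrix.of_apply]
        split_ifs with h
        · rw [← hsg (W i j)]
          linear_combination hsg2 (W i j)
        · ring
      simp_rw [h1]
      rw [Finset.sum_add_distrib, sum_row_sq_of_mem_orthogonalGroup hW]
      simp
      ring
    unfold frobeniusSq
    simp_rw [hrow]
    have hle : ∀ i, W i (σ i) ^ 2 ≤ |W i (σ i)| := by
      intro i
      have h1 : W i (σ i) ^ 2 ≤ 1 := by
        rw [← sum_row_sq_of_mem_orthogonalGroup hW i]
        exact Finset.single_le_sum (f := fun k => W i k ^ 2) (fun _ _ => sq_nonneg _)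
          (Finset.mem_univ _)
      have h2 : |W i (σ i)| ≤ 1 := by rwa [sq_le_one_iff_abs_le_one] at h1
      rw [← sq_abs]
      nlinarith [abs_nonneg (W i (σ i))]
    have hs := Finset.sum_le_sum fun i (_ : i ∈ Finset.univ) => hle i
    rw [Finset.sum_sub_distrib, ← Finset.mul_sum]
    simp
    linarith

theorem l4Pow_of_isSignedPermutation {P : Matrix (Fin n) (Fin n) ℝ} (hP : IsSignedPermutation P) :
    l4Pow P = n := by
  have h : ∀ i j, P i j ^ 4 = P i j ^ 2 := fun i j => by
    rcases hP.2 i j with h | h | h <;> rw [h] <;> norm_num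
  unfold l4Pow
  simp_rw [h, sum_row_sq_of_mem_orthogonalGroup hP.1]
  simp

theorem frobeniusSq_mul_of_mem_orthogonalGroup {D : Matrix (Fin n) (Fin n) ℝ}
    (hD : D ∈ Matrix.orthogonalGroup (Fin n) ℝ) (M : Matrix (Fin n) (Fin p) ℝ) :
    frobeniusSq (D * M) = frobeniusSq M := by
  have htr : ∀ {m : ℕ} (M : Matrix (Fin m) (Fin p) ℝ),
      frobeniusSq M = Matrix.trace (M.transpose * M) := by
    intro m M
    unfold frobeniusSq
    rw [Finset.sum_comm]
    simp [Matrix.trace, Matrix.mul_apply, sq]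
  have hD' : D.transpose * D = 1 := (Matrix.mem_orthogonalGroup_iff' _ _).1 hD
  rw [htr, htr, Matrix.transpose_mul, Matrix.mul_assoc, ← Matrix.mul_assoc D.transpose, hD',
    Matrix.one_mul]

theorem frobeniusSq_transpose (M : Matrix (Fin n) (Fin p) ℝ) :
    frobeniusSq M.transpose = frobeniusSq M := by
  unfold frobeniusSq
  rw [Finset.sum_comm]
  rfl

theorem transpose_mem_orthogonalGroup {W : Matrix (Fin n) (Fin n) ℝ}
    (hW : W ∈ Matrix.orthogonalGroup (Fin n) ℝ) :
    W.transpose ∈ Matrix.orthogonalGroup (Fin n) ℝ := by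
  have := Unitary.star_mem hW
  rwa [Matrix.star_eq_conjTranspose, Matrix.conjTranspose_eq_transpose_of_trivial] at this

theorem isSignedPermutation_transpose {P : Matrix (Fin n) (Fin n) ℝ} (hP : IsSignedPermutation P) :
    IsSignedPermutation P.transpose :=
  ⟨transpose_mem_orthogonalGroup hP.1, fun i j => hP.2 j i⟩

theorem l4Pow_mul_eq {θ : ℝ} {W : Matrix (Fin n) (Fin n) ℝ}
    (hW : W ∈ Matrix.orthogonalGroup (Fin n) ℝ) (X : Matrix (Fin n) (Fin p) ℝ) (hp : 0 < p) :
    l4Pow (W * X) = p * (∑ i, fourthMomentDeviation θ X (WithLp.toLp 2 (W i)) +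
      3 * θ * (1 - θ) * l4Pow W + 3 * θ ^ 2 * n) := by
  have hp' : (p : ℝ) ≠ 0 := by positivity
  have hrow : ∀ i, ∑ j, (W * X) i j ^ 4 = p * (fourthMomentDeviation θ X (WithLp.toLp 2 (W i)) +
      (3 * θ * (1 - θ) * ∑ k, W i k ^ 4 + 3 * θ ^ 2)) := by
    intro i
    simp only [fourthMomentDeviation, Matrix.mul_apply, sum_row_sq_of_mem_orthogonalGroup hW]
    field_simp
    ring
  unfold l4Pow
  simp_rw [hrow]
  rw [← Finset.mul_sum, Finset.sum_add_distrib, Finset.sum_add_distrib, ← Finset.mul_sum,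
    Finset.sum_const, Finset.card_univ, Fintype.card_fin, nsmul_eq_mul]
  ring

theorem norm_toLp_row_of_mem_orthogonalGroup {W : Matrix (Fin n) (Fin n) ℝ}
    (hW : W ∈ Matrix.orthogonalGroup (Fin n) ℝ) (i : Fin n) : ‖WithLp.toLp 2 (W i)‖ ≤ 1 := by
  have : ‖WithLp.toLp 2 (W i)‖ ^ 2 = 1 := by
    rw [EuclideanSpace.real_norm_sq_eq]
    exact sum_row_sq_of_mem_orthogonalGroup hW i
  nlinarith [norm_nonneg (WithLp.toLp 2 (W i))]

/-- If the fourth moment deviation is at most `S` on the unit ball, then a matrix that does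
at least as well as every orthogonal matrix is close to a signed permutation. -/
theorem exists_isSignedPermutation_of_deviation_le {θ : ℝ} (h0 : 0 < θ) (h1 : θ < 1)
    {X : Matrix (Fin n) (Fin p) ℝ} (hp : 0 < p) {S : ℝ}
    (hS : ∀ w : EuclideanSpace ℝ (Fin n), ‖w‖ ≤ 1 → |fourthMomentDeviation θ X w| ≤ S)
    {W : Matrix (Fin n) (Fin n) ℝ} (hW : W ∈ Matrix.orthogonalGroup (Fin n) ℝ)
    (hmax : ∀ B ∈ Matrix.orthogonalGroup (Fin n) ℝ, l4Pow (B * X) ≤ l4Pow (W * X)) :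
    ∃ P, IsSignedPermutation P ∧
      (θ * (1 - θ)) ^ 2 * frobeniusSq (W - P) ≤ 1000000 * S ^ 2 * n := by
  obtain ⟨P, hP, hPW⟩ := exists_isSignedPermutation_frobeniusSq_le hW
  refine ⟨P, hP, ?_⟩
  have hτ : 0 < θ * (1 - θ) := mul_pos h0 (by linarith)
  have hp' : (0 : ℝ) < p := by exact_mod_cast hp
  have hS0 : 0 ≤ S := (abs_nonneg _).trans (hS 0 (by simp))
  have hle := hmax P hP.1
  rw [l4Pow_mul_eq (θ := θ) hW X hp, l4Pow_mul_eq (θ := θ) hP.1 X hp,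
    l4Pow_of_isSignedPermutation hP] at hle
  have hle' := le_of_mul_le_mul_left hle hp'
  -- Bounding the two deviations separately would give F of order nS/τ. The Lipschitz bound on their
  -- difference brings in the distance between `W` and `P` and gives nS²/τ².
  have hlip : ∀ i, fourthMomentDeviation θ X (WithLp.toLp 2 (W i)) -
      fourthMomentDeviation θ X (WithLp.toLp 2 (P i)) ≤
      1000 * S * ‖WithLp.toLp 2 (W i) - WithLp.toLp 2 (P i)‖ := fun i =>
    (le_abs_self _).trans ((isQuarticForm_fourthMomentDeviation θ X).abs_sub_le hS
      (norm_toLp_row_of_mem_orthogonalGroup hP.1 i) (norm_toLp_row_of_mem_orthogonalGroup hW i))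
  have hsum := Finset.sum_le_sum fun i (_ : i ∈ Finset.univ) => hlip i
  rw [Finset.sum_sub_distrib, ← Finset.mul_sum] at hsum
  set Q := ∑ i, ‖WithLp.toLp 2 (W i) - WithLp.toLp 2 (P i)‖ with hQ
  have hfrob : frobeniusSq (W - P) = ∑ i, ‖WithLp.toLp 2 (W i) - WithLp.toLp 2 (P i)‖ ^ 2 := by
    unfold frobeniusSq
    refine Finset.sum_congr rfl fun i _ => ?_
    rw [EuclideanSpace.real_norm_sq_eq]
    rfl
  have hQ2 : Q ^ 2 ≤ n * frobeniusSq (W - P) := by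
    rw [hfrob, hQ]
    simpa using sq_sum_le_card_mul_sum_sq (s := Finset.univ)
      (f := fun i => ‖WithLp.toLp 2 (W i) - WithLp.toLp 2 (P i)‖)
  have hQ0 : 0 ≤ Q := Finset.sum_nonneg fun _ _ => norm_nonneg _
  set F := frobeniusSq (W - P) with hF
  have hF0 : 0 ≤ F := by rw [hfrob]; positivity
  set τ := θ * (1 - θ) with hτdef
  have hkey : τ * F ≤ 1000 * S * Q := by
    have e1 : 3 * θ * (1 - θ) = 3 * τ := by rw [hτdef]; ring
    rw [e1] at hle'
    have e2 : τ * F ≤ τ * (2 * (n - l4Pow W)) := mul_le_mul_of_nonneg_left hPW hτ.le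
    have e3 : 0 ≤ τ * F := by positivity
    nlinarith
  rcases eq_or_lt_of_le hF0 with hz | hpos
  · rw [← hz]; simp; positivity
  -- Self-bounding: Q² ≤ nF, so squaring allows one factor F to be cancelled.
  · have hsq : (τ * F) ^ 2 ≤ (1000 * S * Q) ^ 2 := pow_le_pow_left₀ (by positivity) hkey 2
    have h3 : (1000 * S * Q) ^ 2 ≤ 1000000 * S ^ 2 * (n * F) := by
      calc _ = 1000000 * S ^ 2 * Q ^ 2 := by ring
        _ ≤ _ := by gcongr
    refine le_of_mul_le_mul_right ?_ hpos
    calc τ ^ 2 * F * F = (τ * F) ^ 2 := by ring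
      _ ≤ 1000000 * S ^ 2 * (n * F) := hsq.trans h3
      _ = _ := by ring

end Deterministic

/-! ### Sample size and conclusion. -/

/-- The sample size condition dominates any fixed multiple of `(n + log p) ^ 2`. -/
theorem exists_forall_mul_sq_le {θ : ℝ} (hθ : 0 < θ) {R : ℝ} (hR : 0 < R) :
    ∃ p₀ : ℕ, 1 ≤ p₀ ∧ ∀ (n p : ℕ) (ε : ℝ), 2 ≤ n → 0 ≤ ε → ε ≤ 1 → p₀ ≤ p →
      θ * (n : ℝ) ^ 2 * Real.log n ≤ p * ε ^ 2 → R * (n + Real.log p) ^ 2 ≤ p * ε := by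
  have hl : Filter.Tendsto (fun p : ℕ => Real.log p) Filter.atTop Filter.atTop :=
    Real.tendsto_log_atTop.comp tendsto_natCast_atTop_atTop
  have hev1 := hl.eventually_ge_atTop (Real.exp (4 * R / θ))
  have ho : (fun x : ℝ => Real.log x ^ 4) =o[Filter.atTop] fun x => x :=
    Real.isLittleO_pow_log_id_atTop (n := 4)
  have hev2 := (ho.comp_tendsto tendsto_natCast_atTop_atTop).bound
    (show 0 < θ / (16 * R ^ 2) by positivity)
  obtain ⟨p₁, hp₁⟩ := Filter.eventually_atTop.1 (hev1.and hev2)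
  refine ⟨max p₁ 1, le_max_right _ _, fun n p ε hn hε0 hε1 hp hle => ?_⟩
  obtain ⟨hA, hB⟩ := hp₁ p ((le_max_left _ _).trans hp)
  have hp1 : (1 : ℝ) ≤ p := by exact_mod_cast (le_max_right _ _).trans hp
  have hn' : (2 : ℝ) ≤ n := by exact_mod_cast hn
  have hℓ : 0 < Real.log p := (Real.exp_pos _).trans_le hA
  simp only [Function.comp_apply, Real.norm_of_nonneg (pow_nonneg hℓ.le 4),
    Real.norm_of_nonneg (zero_le_one.trans hp1)] at hB
  -- If n ≥ log p, then log n ≥ log log p is large and the logarithm in the sample condition absorbs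
  -- 4R/θ. If n ≤ log p, only pε² ≥ θ is kept, and log⁴ p = o(p) finishes after squaring.
  rcases le_total (Real.log p) n with h | h
  · have h1 : 4 * R / θ ≤ Real.log n := by
      rw [Real.le_log_iff_exp_le (by linarith)]
      exact hA.trans h
    have h2 : 4 * R ≤ θ * Real.log n := by
      rw [div_le_iff₀ hθ] at h1
      linarith
    calc R * (n + Real.log p) ^ 2 ≤ R * (n + n) ^ 2 := by gcongr
      _ = 4 * R * (n : ℝ) ^ 2 := by ring
      _ ≤ θ * Real.log n * (n : ℝ) ^ 2 := by gcongr
      _ = θ * (n : ℝ) ^ 2 * Real.log n := by ring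
      _ ≤ p * ε ^ 2 := hle
      _ ≤ p * ε := by gcongr; nlinarith
  · have hlog2 : 1 / 4 ≤ Real.log n := by
      have := Real.log_le_log (by norm_num) hn'
      linarith [Real.log_two_gt_d9]
    have h1 : θ ≤ p * ε ^ 2 := by
      refine le_trans ?_ hle
      have : (4 : ℝ) ≤ (n : ℝ) ^ 2 := by nlinarith
      calc θ = θ * 4 * (1 / 4) := by ring
        _ ≤ _ := by gcongr
    refine (sq_le_sq₀ (by positivity) (by positivity)).1 ?_
    calc (R * (n + Real.log p) ^ 2) ^ 2 ≤ (R * (Real.log p + Real.log p) ^ 2) ^ 2 := by gcongr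
      _ = 16 * R ^ 2 * Real.log p ^ 4 := by ring
      _ ≤ 16 * R ^ 2 * (θ / (16 * R ^ 2) * p) := by gcongr
      _ = θ * p := by field_simp
      _ ≤ p * ε ^ 2 * p := by gcongr
      _ = (p * ε) ^ 2 := by ring

/-- In dimension at most one every orthogonal matrix is a signed permutation. -/
theorem isSignedPermutation_of_le_one {n : ℕ} (hn : n ≤ 1) {P : Matrix (Fin n) (Fin n) ℝ}
    (hP : P ∈ Matrix.orthogonalGroup (Fin n) ℝ) : IsSignedPermutation P := by
  refine ⟨hP, fun i j => Or.inr ?_⟩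
  have : Subsingleton (Fin n) := Fin.subsingleton_iff_le_one.2 hn
  have h := sum_row_sq_of_mem_orthogonalGroup hP i
  rw [Fintype.sum_eq_single j fun k hk => absurd (Subsingleton.elim k j) hk] at h
  exact mul_self_eq_one_iff.1 (by rw [← sq]; exact h)

theorem theorem2p5 :
    -- `K` is an absolute constant, the implied constant of the sample complexity bound
    ∃ K : ℝ, 0 < K ∧
    ∀ θ : unitInterval, 0 < (θ : ℝ) → (θ : ℝ) < 1 →
    -- `p₀` depends on `θ` alone
    ∃ p₀ : ℕ,
    ∀ C : ℝ, 4 / (3 * (θ : ℝ) * (1 - (θ : ℝ))) < C →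
    ∀ (n p : ℕ) (ε : ℝ), 0 ≤ ε → ε ≤ 1 → p₀ ≤ p →
      K * ((θ : ℝ) * (n : ℝ) ^ 2 * Real.log n) ≤ (p : ℝ) * ε ^ 2 →
    ∀ D ∈ Matrix.orthogonalGroup (Fin n) ℝ,
    ∀ (Ω : Type*) [MeasurableSpace Ω] (μ : Measure Ω) [IsProbabilityMeasure μ]
      (X : Ω → Matrix (Fin n) (Fin p) ℝ), IsBernoulliGaussianMatrix μ θ X →
    ∃ E : Set Ω, MeasurableSet E ∧ 1 - 1 / (p : ℝ) ≤ μ.real E ∧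
      ∀ ω ∈ E, ∀ A : Matrix (Fin n) (Fin n) ℝ, IsGlobalL4Maximizer (D * X ω) A →
        ∃ P : Matrix (Fin n) (Fin n) ℝ, IsSignedPermutation P ∧
          1 / (n : ℝ) * frobeniusSq (A.transpose - D * P) ≤ C * ε := by
  -- `K = 1` suffices, since the threshold `p₀` may depend on θ and absorbs all constants.
  refine ⟨1, one_pos, fun θ h0 h1 => ?_⟩
  have hτ : 0 < (θ : ℝ) * (1 - θ) := mul_pos h0 (by linarith)
  have hτ1 : (θ : ℝ) * (1 - θ) ≤ 1 := by nlinarith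
  set τ : ℝ := (θ : ℝ) * (1 - θ) with hτdef
  -- With S = τ√ε/4000 the concentration lemma requires τ²pε ≥ 4400000 · 4000² · m, about 7·10¹³ m;
  -- 10¹⁴ leaves room, as m ≥ 1.
  obtain ⟨p₀, hp₀, hsample⟩ := exists_forall_mul_sq_le h0
    (show 0 < 100000000000000 / τ ^ 2 by positivity)
  refine ⟨p₀, fun C hC n p ε hε0 hε1 hp hpε D hD Ω _ μ _ X hX => ?_⟩
  have hp1 : 1 ≤ p := hp₀.trans hp
  have hp1' : (1 : ℝ) ≤ p := by exact_mod_cast hp1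
  -- This is all that is used of the bound on `C`; the argument yields the constant 1/4.
  have hC1 : 1 ≤ C := by
    have : (4 : ℝ) / 3 ≤ 4 / (3 * θ * (1 - θ)) := by
      rw [mul_assoc, ← hτdef]
      gcongr
      linarith
    linarith
  have hWmem : ∀ {A : Matrix (Fin n) (Fin n) ℝ}, A ∈ Matrix.orthogonalGroup (Fin n) ℝ →
      A * D ∈ Matrix.orthogonalGroup (Fin n) ℝ := fun hA => mul_mem hA hD
  have hDD : D * D.transpose = 1 := (Matrix.mem_orthogonalGroup_iff _ _).1 hD
  have hDD' : D.transpose * D = 1 := (Matrix.mem_orthogonalGroup_iff' _ _).1 hD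
  -- For n ≤ 1 the sample condition is void because `Real.log n = 0`, but then `A * D` is itself a
  -- signed permutation and the error is zero.
  rcases Nat.lt_or_ge n 2 with hn | hn
  · refine ⟨Set.univ, MeasurableSet.univ, ?_, fun ω _ A hA => ⟨(A * D).transpose,
      isSignedPermutation_of_le_one (by omega) (transpose_mem_orthogonalGroup (hWmem hA.1)), ?_⟩⟩
    · simp
    · have : D * (A * D).transpose = A.transpose := by
        rw [Matrix.transpose_mul, ← Matrix.mul_assoc, hDD, Matrix.one_mul]
      rw [this, sub_self]
      have : 0 ≤ C * ε := by positivity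
      simpa [frobeniusSq] using this
  · have hm := hsample n p ε hn hε0 hε1 hp (by simpa using hpε)
    have hn' : (2 : ℝ) ≤ n := by exact_mod_cast hn
    have hlog : 0 ≤ Real.log p := Real.log_nonneg hp1'
    set m : ℝ := n + Real.log p with hmdef
    have hm1 : 1 ≤ m := by linarith
    have hmm : 100000000000000 * m ^ 2 ≤ τ ^ 2 * (p * ε) := by
      rw [div_mul_eq_mul_div, div_le_iff₀ (by positivity)] at hm
      linarith
    have hεpos : 0 < ε := by
      rcases eq_or_lt_of_le hε0 with h | h
      · rw [← h] at hmm
        nlinarith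
      · exact h
    -- Chosen so that 10⁶(2S)² = τ²ε/4.
    set S : ℝ := τ * √ε / 4000 with hSdef
    have hS : 0 < S := by positivity
    have hsq : √ε ^ 2 = ε := Real.sq_sqrt hε0
    have hεs : ε ≤ √ε := Real.le_sqrt_of_sq_le (by nlinarith)
    have hS1 : 2112 * m ^ 2 ≤ p * S := by
      have e1 : τ ^ 2 * (p * ε) ≤ τ * (p * √ε) := by
        calc τ ^ 2 * (p * ε) = τ * τ * (p * ε) := by ring
          _ ≤ τ * 1 * (p * √ε) := by gcongr
          _ = _ := by ring
      have e2 : p * S = τ * (p * √ε) / 4000 := by rw [hSdef]; ring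
      rw [e2]
      nlinarith
    have hS2 : 4400000 * m ≤ p * S ^ 2 := by
      have e2 : p * S ^ 2 = τ ^ 2 * (p * ε) / 16000000 := by
        rw [hSdef, div_pow, mul_pow, hsq]; ring
      rw [e2]
      nlinarith
    have hprob := measureReal_fourthMomentDeviation_le hX (by omega) hp1 hS hS1 hS2
    set bad : Set Ω := {ω | ¬ ∀ w : EuclideanSpace ℝ (Fin n), ‖w‖ ≤ 1 →
      |fourthMomentDeviation θ (X ω) w| ≤ 2 * S} with hbad
    -- The entries are only a.e. measurable, so `bad` is replaced by a measurable hull of the same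
    -- measure.
    refine ⟨(toMeasurable μ bad)ᶜ, (measurableSet_toMeasurable μ bad).compl, ?_, ?_⟩
    · rw [probReal_compl_eq_one_sub (measurableSet_toMeasurable μ bad), measureReal_def,
        measure_toMeasurable, ← measureReal_def]
      linarith
    · intro ω hω A hA
      have hgood : ∀ w : EuclideanSpace ℝ (Fin n), ‖w‖ ≤ 1 →
          |fourthMomentDeviation θ (X ω) w| ≤ 2 * S := by
        by_contra hcon
        exact hω (subset_toMeasurable μ bad hcon)
      have hmax : ∀ B ∈ Matrix.orthogonalGroup (Fin n) ℝ,
          l4Pow (B * X ω) ≤ l4Pow (A * D * X ω) := by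
        intro B hB
        have := hA.2 (B * D.transpose) (mul_mem hB (transpose_mem_orthogonalGroup hD))
        rwa [Matrix.mul_assoc, ← Matrix.mul_assoc D.transpose, hDD', Matrix.one_mul,
          ← Matrix.mul_assoc] at this
      obtain ⟨P, hP, hPW⟩ := exists_isSignedPermutation_of_deviation_le h0 h1
        (by omega) hgood (hWmem hA.1) hmax
      refine ⟨P.transpose, isSignedPermutation_transpose hP, ?_⟩
      have hfrob : frobeniusSq (A.transpose - D * P.transpose) = frobeniusSq (A * D - P) := by
        have : A.transpose - D * P.transpose = D * (A * D - P).transpose := by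
          rw [Matrix.transpose_sub, Matrix.mul_sub, Matrix.transpose_mul, ← Matrix.mul_assoc, hDD,
            Matrix.one_mul]
        rw [this, frobeniusSq_mul_of_mem_orthogonalGroup hD, frobeniusSq_transpose]
      rw [hfrob, one_div, inv_mul_le_iff₀ (by linarith)]
      have h4 : 1000000 * (2 * S) ^ 2 * n = τ ^ 2 * (ε / 4 * n) := by
        rw [hSdef, mul_pow, div_pow, mul_pow, hsq]; ring
      rw [h4] at hPW
      have h5 := le_of_mul_le_mul_left hPW (by positivity)
      calc _ ≤ ε / 4 * n := h5
        _ ≤ n * (1 * ε) := by nlinarith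
        _ ≤ n * (C * ε) := by gcongr
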